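/- Work over $\mathbb{C}$, and let $\mathbb{A}^2_*=\operatorname{Spec}\mathbb{C}[x,y]\setminus\{(0,0)\}$ with the action of $\mathbb{G}_m$ by $\lambda\cdot(x,y)=(\lambda x,\lambda y)$. A $\mathbb{G}_a$-bundle over $\mathbb{A}^2_*$ is a scheme $\rho:X\to\mathbb{A}^2_*$ with a $\mathbb{G}_a$-action over $\mathbb{A}^2_*$ that is Zariski locally on $\mathbb{A}^2_*$ equivariantly isomorphic to $U\times\mathbb{G}_a$ with $\mathbb{G}_a$ acting by translations; it is nontrivial if it is not equivariantly isomorphic to $\mathbb{A}^2_*\times\mathbb{G}_a$ over $\mathbb{A}^2_*$. It is homogeneous of degree $-d$ if there are a covering of $\mathbb{A}^2_*$ by $\mathbb{G}_m$-stable affine open subsets $U_i$ and $\mathbb{G}_a$-equivariant trivializations $X|_{U_i}\simeq U_i\times\mathbb{G}_a$ whose transition isomorphisms $(z,t_j)\mapsto(z,t_j+h_{ij}(z))$ over $U_i\cap U_j$ are given by rational functions $h_{ij}\in\mathbb{C}(x,y)$ that are homogeneous of degree $-d$; equivalently, if the class of the bundle in $H^1(\mathbb{A}^2_*,\mathcal{O})=\bigoplus_{k}H^1(\mathbb{P}^1,\mathcal{O}(k))$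 lies in $H^1(\mathbb{P}^1,\mathcal{O}(-d))$. For integers $m,n\ge 1$ let $X_{m,n}=\{x^mv-y^nu=1\}\subset\mathbb{A}^2_*\times\mathbb{A}^2=\mathbb{A}^2_*\times\operatorname{Spec}\mathbb{C}[u,v]$ (which is also closed in $\mathbb{A}^4$), and let $\mathbb{S}^n_{\mathbb{C}}=\{z_1^2+\cdots+z_{n+1}^2=1\}\subset\mathbb{A}^{n+1}$. An exotic affine $n$-sphere is a smooth complex affine variety whose set of complex points is diffeomorphic to that of $\mathbb{S}^n_{\mathbb{C}}$, but which is not isomorphic to $\mathbb{S}^n_{\mathbb{C}}$ as an algebraic variety over $\mathbb{C}$. (1) If $d>2$, then the total space $X$ of a nontrivial homogeneous $\mathbb{G}_a$-bundle $\rho:X\to\mathbb{A}^2_*$ of degree $-d$ is not isomorphic to $X_{1,1}$ as an algebraic variety over $\mathbb{C}$. (2) As algebraic varieties over $\mathbb{C}$, $X_{1,1}\simeq\mathrm{SL}_2\simeq\mathbb{S}^3_{\mathbb{C}}$. (3) For all integers $m,n\ge 1$ with $m+n\ge 3$, the variety $X_{m,n}$ is an exotic affine $3$-sphere. -/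

import Mathlib

noncomputable section

open CategoryTheory AlgebraicGeometry

namespace ExoticSphere

/-! ### The punctured affine plane with its scaling action -/

/-- The base scheme `Spec ℂ`. Complex varieties are objects of `Over SpecC`. -/
abbrev SpecC : Scheme.{0} := Spec (CommRingCat.of ℂ)

/-- The polynomial ring `ℂ[x, y]`, with `x = X 0` and `y = X 1`. -/
abbrev Cxy : Type := MvPolynomial (Fin 2) ℂ

/-- The affine plane `Spec ℂ[x, y]`. -/
abbrev A2 : Scheme.{0} := Spec (CommRingCat.of Cxy)

/-- The complement of the origin `{x = y = 0}` in the affine plane. -/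
def punctured : A2.Opens :=
  ⟨(PrimeSpectrum.zeroLocus {(MvPolynomial.X 0 : Cxy), MvPolynomial.X 1})ᶜ,
    (PrimeSpectrum.isClosed_zeroLocus _).isOpen_compl⟩

/-- The punctured affine plane `𝔸²_*`. -/
abbrev A2star : Scheme.{0} := punctured.toScheme

/-- The structure morphism of `𝔸²_*` over `ℂ`. -/
def A2star.toSpecC : A2star ⟶ SpecC :=
  punctured.ι ≫ Spec.map (CommRingCat.ofHom (MvPolynomial.C : ℂ →+* Cxy))

/-- The automorphism `(x, y) ↦ (c x, c y)` of the affine plane, for `c ∈ ℂ*`. -/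
def scale (c : ℂˣ) : A2 ⟶ A2 :=
  Spec.map (CommRingCat.ofHom
    (MvPolynomial.aeval (R := ℂ)
      (fun i : Fin 2 => (MvPolynomial.C (c : ℂ) * MvPolynomial.X i : Cxy))).toRingHom)

/-- An open subset of `𝔸²_*` is stable under the action of `𝔾ₘ` by scaling. -/
def IsGmStable (U : A2star.Opens) : Prop :=
  ∀ c : ℂˣ, scale c ⁻¹ᵁ (punctured.ι ''ᵁ U) = punctured.ι ''ᵁ U

/-- A polynomial in `x, y` as a regular function on an open subset of `𝔸²_*`. -/
def polyOn (U : A2star.Opens) (p : Cxy) : Γ(A2star, U) :=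
  A2star.presheaf.map (homOfLE (le_top : U ≤ ⊤)).op
    (punctured.ι.appTop ((Scheme.ΓSpecIso (CommRingCat.of Cxy)).inv p))

/-- The regular function `h` on `U ⊆ 𝔸²_*` is, as a rational function in `ℂ(x, y)`, homogeneous
of degree `e`: it is a quotient `p / q` of homogeneous polynomials with `deg p - deg q = e`. -/
def IsHomogeneousFun {U : A2star.Opens} (h : Γ(A2star, U)) (e : ℤ) : Prop :=
  ∃ (a b : ℕ) (p q : Cxy), p.IsHomogeneous a ∧ q.IsHomogeneous b ∧ q ≠ 0 ∧
    (a : ℤ) - (b : ℤ) = e ∧ polyOn U q * h = polyOn U p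

/-! ### Principal `𝔾ₐ`-bundles -/

/-- A scheme `ρ : X ⟶ S` over `S` with an action of the additive group `𝔾ₐ` over `S`. The action
`𝔾_{a,S} ×_S X ⟶ X` is a morphism `act` from the affine line over `X`. -/
structure GaScheme (S : Scheme.{0}) where
  /-- the total space -/
  X : Scheme.{0}
  /-- the projection -/
  ρ : X ⟶ S
  /-- the action -/
  act : 𝔸(Unit; X) ⟶ X

/-- The action on `T`-points: for `s ∈ 𝔾ₐ(T) = Γ(T, 𝒪_T)` and `f ∈ X(T)`, the point `s · f`. -/
def GaScheme.translate {S : Scheme.{0}} (B : GaScheme S) {T : Scheme.{0}}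
    (s : Γ(T, ⊤)) (f : T ⟶ B.X) : T ⟶ B.X :=
  AffineSpace.homOfVector f (fun _ : Unit => s) ≫ B.act

/-- A `𝔾ₐ`-equivariant trivialization `X|_U ≅ U × 𝔾ₐ` over an open `U ⊆ S`, given by its fibre
coordinate `t`, a regular function on `ρ⁻¹(U)`: the morphism `(ρ, t) : ρ⁻¹(U) ⟶ 𝔸¹_U` is an
isomorphism, and `t (s · z) = t (z) + s`. -/
structure GaScheme.Trivialization {S : Scheme.{0}} (B : GaScheme S) (U : S.Opens) where
  /-- the fibre coordinate -/
  coord : Γ(B.X, B.ρ ⁻¹ᵁ U)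
  isIso : IsIso (AffineSpace.homOfVector (B.ρ ∣_ U)
    (fun _ : Unit => (B.ρ ⁻¹ᵁ U).topIso.inv coord))
  equivariant : ∀ {T : Scheme.{0}} (s : Γ(T, ⊤)) (f g : T ⟶ (B.ρ ⁻¹ᵁ U).toScheme),
    g ≫ (B.ρ ⁻¹ᵁ U).ι = B.translate s (f ≫ (B.ρ ⁻¹ᵁ U).ι) →
      g.appTop ((B.ρ ⁻¹ᵁ U).topIso.inv coord) = f.appTop ((B.ρ ⁻¹ᵁ U).topIso.inv coord) + s

/-- A (Zariski locally trivial) principal `𝔾ₐ`-bundle over `S`. -/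
structure GaBundle (S : Scheme.{0}) extends GaScheme S where
  act_over : act ≫ ρ = (𝔸(Unit; X) ↘ X) ≫ ρ
  zero_translate : ∀ {T : Scheme.{0}} (f : T ⟶ X), toGaScheme.translate 0 f = f
  add_translate : ∀ {T : Scheme.{0}} (s t : Γ(T, ⊤)) (f : T ⟶ X),
    toGaScheme.translate (s + t) f = toGaScheme.translate s (toGaScheme.translate t f)
  locally_trivial : ∀ z : S, ∃ U : S.Opens, z ∈ U ∧ Nonempty (toGaScheme.Trivialization U)

namespace GaBundle

/-- A `𝔾ₐ`-bundle over `S` is nontrivial if it is not equivariantly isomorphic to `S × 𝔾ₐ`. -/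
def IsNontrivial {S : Scheme.{0}} (B : GaBundle S) : Prop :=
  IsEmpty (B.toGaScheme.Trivialization ⊤)

/-- `h` is the transition function `t - t'` on `U ∩ V` between two trivializations with fibre
coordinates `t` over `U` and `t'` over `V`. -/
def IsTransition {S : Scheme.{0}} (B : GaBundle S) {U V : S.Opens}
    (τ : B.toGaScheme.Trivialization U) (τ' : B.toGaScheme.Trivialization V)
    (h : Γ(S, U ⊓ V)) : Prop :=
  B.ρ.app (U ⊓ V) h =
    B.X.presheaf.map (homOfLE (B.ρ.preimage_mono (inf_le_left : U ⊓ V ≤ U))).op τ.coord -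
    B.X.presheaf.map (homOfLE (B.ρ.preimage_mono (inf_le_right : U ⊓ V ≤ V))).op τ'.coord

/-- The `𝔾ₐ`-bundle `B` over `𝔸²_*` is homogeneous of degree `e`: its class in
`H¹(𝔸²_*, 𝒪) = H¹(ℙ¹, π_* 𝒪) = ⨁ₖ H¹(ℙ¹, 𝒪(k))` lies in the summand `H¹(ℙ¹, 𝒪(e))`, which means
that it is represented, over a covering of `𝔸²_*` by `𝔾ₘ`-stable affine open subsets, by a Čech
cocycle that consists of homogeneous rational functions of degree `e`. -/
def IsHomogeneous (B : GaBundle A2star) (e : ℤ) : Prop :=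
  ∃ (ι : Type) (U : ι → A2star.Opens) (τ : ∀ i, B.toGaScheme.Trivialization (U i)),
    (⨆ i, U i) = ⊤ ∧
    (∀ i, IsAffineOpen (U i) ∧ IsGmStable (U i)) ∧
    ∀ i j, ∃ h : Γ(A2star, U i ⊓ U j), IsHomogeneousFun h e ∧ B.IsTransition (τ i) (τ j) h

/-- The total space of a `𝔾ₐ`-bundle over `𝔸²_*`, as an abstract scheme over `ℂ`. -/
def totalSpace (B : GaBundle A2star) : Over SpecC :=
  Over.mk (B.ρ ≫ A2star.toSpecC)

end GaBundle

/-! ### The affine varieties -/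

/-- The affine hypersurface `{f = 0}` over `ℂ`, for a polynomial `f` in variables indexed
by `σ`. -/
def hypersurface {σ : Type} (f : MvPolynomial σ ℂ) : Over SpecC :=
  Over.mk (Spec.map (CommRingCat.ofHom
    (algebraMap ℂ (MvPolynomial σ ℂ ⧸ Ideal.span {f}))))

/-- The threefold `X_{m,n} = {x^m v - y^n u = 1}`, with coordinates `(x, y, u, v)` numbered
`0, 1, 2, 3`. For `m, n ≥ 1` it does not meet `{x = y = 0}`, so that it is the same closed
subscheme in `𝔸⁴` as in `𝔸²_* × 𝔸²`. -/
def Xmn (m n : ℕ) : Over SpecC :=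
  hypersurface (σ := Fin 4)
    (MvPolynomial.X 0 ^ m * MvPolynomial.X 3 - MvPolynomial.X 1 ^ n * MvPolynomial.X 2 - 1)

/-- The variety `SL₂` over `ℂ`, defined by `det = 1` in the space of `2 × 2` matrices. -/
def SL2 : Over SpecC :=
  hypersurface (Matrix.det (Matrix.mvPolynomialX (Fin 2) (Fin 2) ℂ) - 1)

/-- The complex affine `n`-sphere `{z₁² + ⋯ + zₙ₊₁² = 1}`. -/
def sphere (n : ℕ) : Over SpecC :=
  hypersurface (σ := Fin (n + 1)) (∑ i, MvPolynomial.X i ^ 2 - 1)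

/-! ### The underlying differentiable manifold of a smooth affine variety -/

/-- The set `V(ℂ)` of complex points. -/
abbrev Points (V : Over SpecC) : Type := Over.mk (𝟙 SpecC) ⟶ V

/-- The value of a regular function at a complex point. -/
def value {V : Over SpecC} (f : Γ(V.left, ⊤)) (z : Points V) : ℂ :=
  (Scheme.ΓSpecIso (CommRingCat.of ℂ)).hom (z.left.appTop f)

/-- For a smooth affine variety `V`, the function `s` on `V(ℂ)` is of class `C^∞` for the underlying
differentiable manifold. Locally for the Euclidean topology, `s` is a `C^∞` function of finitely
many regular functions. For `V` closed in `𝔸ᴺ` this says that `s` is locally the restriction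
of a `C^∞` function on an open subset of `ℂᴺ`. -/
def IsSmoothFun {V : Over SpecC} (s : Points V → ℂ) : Prop :=
  ∀ z : Points V, ∃ (k : ℕ) (f : Fin k → Γ(V.left, ⊤)) (W : Set (Fin k → ℂ))
    (G : (Fin k → ℂ) → ℂ),
    IsOpen W ∧ (fun i => value (f i) z) ∈ W ∧ ContDiffOn ℝ ((⊤ : ℕ∞) : WithTop ℕ∞) G W ∧
    ∀ w : Points V, (fun i => value (f i) w) ∈ W → s w = G (fun i => value (f i) w)

/-- Two smooth affine varieties are diffeomorphic: there is a bijection between their sets of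
complex points that is `C^∞` in both directions, that is, whose components with respect
to the regular functions (in particular, to the coordinates of any closed embedding in an affine
space) are `C^∞` functions. -/
def Diffeomorphic (V V' : Over SpecC) : Prop :=
  ∃ φ : Points V ≃ Points V',
    (∀ g : Γ(V'.left, ⊤), IsSmoothFun (fun z : Points V => value g (φ z))) ∧
    (∀ f : Γ(V.left, ⊤), IsSmoothFun (fun z : Points V' => value f (φ.symm z)))

/-- An exotic affine `n`-sphere: a smooth complex affine variety that is diffeomorphic, but not
isomorphic as an algebraic variety over `ℂ`, to the complex affine `n`-sphere. -/
structure IsExoticSphere (n : ℕ) (V : Over SpecC) : Prop where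
  isAffine : IsAffine V.left
  isIntegral : IsIntegral V.left
  smooth : Smooth V.hom
  diffeomorphic : Diffeomorphic V (sphere n)
  not_iso : IsEmpty (V ≅ sphere n)

end ExoticSphere

end

noncomputable section

namespace ExoticSphere

open MvPolynomial

/-! ### The Haar functional on polynomial functions on `2 × 2` matrices -/

/-! The obstruction is the divergence of an Euler vector field. On a homogeneous bundle of degree
$-d$, with local coordinates $(x,y,t_i)$, put $E = x\partial_x + y\partial_y -
d\,t_i\partial_{t_i}$. Since $t_i - t_j$ is homogeneous of degree $-d$ in $x,y$, these fields agree
on overlaps, so $E$ is a global derivation. The forms $dx\wedge dy\wedge dt_i$ also agree, because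
$t_i - t_j$ involves only $x$ and $y$, and $E$ scales the resulting volume form with weight $1+1-d =
2-d$.

Suppose that the total space is $\mathrm{SL}_2$. The ratio $J$ of this volume form to the invariant
one is a unit, and derivations kill units because a unit is constant along unipotent flows
(`IsGenericSL2.derivation_unit`). Hence the divergence of $E$ with respect to the invariant form is
also $2-d$ (`InvariantFrame.divergence_eq`). The Haar functional kills the left invariant
derivatives of regular functions and takes the value $1$ at $1$, so a constant divergence vanishes
(`eq_zero_of_divergence_mem`). Therefore $d = 2$ (`IsGenericSL2.degree_eq_two`).

The computation takes place in the function field. A chart enters only through the local ring at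
each prime, as a localization of $\mathbb{C}[x,y,t]$ (`degree_eq_two_of_local`). This form of the
statement serves twice: for a bundle whose total space is isomorphic to $X_{1,1}$
(`GaBundle.degree_eq_two`), and for $X_{m,n}$ with $t = u/x^m$ or $t = v/y^n$, whose difference is
$\pm 1/(x^my^n)$, of degree $-(m+n)$ (`add_eq_two_of_coordRing_equiv`).

The diffeomorphism exists because the bundle $X_{m,n}$ is smoothly trivial: complex conjugation
gives the section $(u,v) = (-\bar y^n,\bar x^m)/(|x|^{2m}+|y|^{2n})$. All $X_{m,n}$ are thus
diffeomorphic over the punctured plane (`fibreMap_spec`), and $X_{1,1}$ becomes the sphere by a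
linear change of coordinates. -/

/-- The equation `x^m v - y^n u - 1` of `X_{m,n}`. -/
def equation (m n : ℕ) : MvPolynomial (Fin 4) ℂ := X 0 ^ m * X 3 - X 1 ^ n * X 2 - 1

/-- The value of the Haar functional of `SL₂` on the monomial `x^a y^b u^c v^e`. -/
def haarCoeff (a b c e : ℕ) : ℂ :=
  -- On $\mathrm{SU}(2)$ one has $v = \bar x$ and $u = -\bar y$, so this is the integral of
  -- $(-1)^b|x|^{2a}|y|^{2b}$ over the unit sphere with its normalized measure. All other monomials
  -- have nonzero weight under a torus and integrate to zero.
  if a = e ∧ b = c then (-1) ^ b * (a.factorial : ℂ) * b.factorial / (a + b + 1).factorial else 0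

/-- The Haar functional of `SL₂ = {x v - y u = 1}`, on polynomials in `x, y, u, v`. -/
def haar : MvPolynomial (Fin 4) ℂ →ₗ[ℂ] ℂ :=
  (MvPolynomial.basisMonomials (Fin 4) ℂ).constr ℂ
    (fun s => haarCoeff (s 0) (s 1) (s 2) (s 3))

lemma monomial_fin_four (s : Fin 4 →₀ ℕ) (r : ℂ) :
    (monomial s r : MvPolynomial (Fin 4) ℂ) =
      r • (X 0 ^ s 0 * X 1 ^ s 1 * X 2 ^ s 2 * X 3 ^ s 3) := by
  rw [monomial_eq, Finsupp.prod_fintype _ _ (by simp), Fin.prod_univ_four, smul_eq_C_mul]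

lemma haar_pow (a b c e : ℕ) :
    haar (X 0 ^ a * X 1 ^ b * X 2 ^ c * X 3 ^ e) = haarCoeff a b c e := by
  have h := monomial_fin_four (Finsupp.equivFunOnFinite.symm ![a, b, c, e]) 1
  simp only [one_smul] at h
  have h2 : haar (monomial (Finsupp.equivFunOnFinite.symm ![a, b, c, e]) 1) =
      haarCoeff a b c e := by
    have h3 : monomial (Finsupp.equivFunOnFinite.symm ![a, b, c, e]) (1 : ℂ) =
      MvPolynomial.basisMonomials (Fin 4) ℂ (Finsupp.equivFunOnFinite.symm ![a, b, c, e]) := by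
      simp
    rw [h3, haar, Module.Basis.constr_basis]
    simp
  rw [h] at h2
  simpa using h2

lemma linearMap_eq_zero_of_pow {φ : MvPolynomial (Fin 4) ℂ →ₗ[ℂ] ℂ}
    (h : ∀ a b c e : ℕ, φ (X 0 ^ a * X 1 ^ b * X 2 ^ c * X 3 ^ e) = 0)
    (p : MvPolynomial (Fin 4) ℂ) : φ p = 0 := by
  induction p using MvPolynomial.induction_on' with
  | monomial s r => rw [monomial_fin_four, map_smul, h, smul_zero]
  | add p q hp hq => rw [map_add, hp, hq, add_zero]

/-- The left invariant vector field `e` on `SL₂`, on polynomials. -/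
def derE : Derivation ℂ (MvPolynomial (Fin 4) ℂ) (MvPolynomial (Fin 4) ℂ) :=
  -- For $g$ with rows $(x,y)$ and $(u,v)$, the field is $g \mapsto g\,E_{12}$. The next two use
  -- $E_{21}$ and $\mathrm{diag}(1,-1)$ in the same way.
  mkDerivation ℂ ![0, X 0, 0, X 2]

/-- The left invariant vector field `f` on `SL₂`, on polynomials. -/
def derF : Derivation ℂ (MvPolynomial (Fin 4) ℂ) (MvPolynomial (Fin 4) ℂ) :=
  mkDerivation ℂ ![X 1, 0, X 3, 0]

/-- The left invariant vector field `h` on `SL₂`, on polynomials. -/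
def derH : Derivation ℂ (MvPolynomial (Fin 4) ℂ) (MvPolynomial (Fin 4) ℂ) :=
  mkDerivation ℂ ![X 0, -X 1, X 2, -X 3]

/-- The functional descends to the coordinate ring by the recursion $\frac{(a+1)!\,b!}{(a+b+2)!} +
\frac{a!\,(b+1)!}{(a+b+2)!} = \frac{a!\,b!}{(a+b+1)!}$. -/
lemma haar_equation_mul (p : MvPolynomial (Fin 4) ℂ) : haar (p * equation 1 1) = 0 := by
  refine linearMap_eq_zero_of_pow (φ := haar ∘ₗ LinearMap.mulRight ℂ (equation 1 1))
    (fun a b c e => ?_) p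
  have h : (X 0 ^ a * X 1 ^ b * X 2 ^ c * X 3 ^ e * equation 1 1 : MvPolynomial (Fin 4) ℂ) =
      X 0 ^ (a + 1) * X 1 ^ b * X 2 ^ c * X 3 ^ (e + 1) -
      X 0 ^ a * X 1 ^ (b + 1) * X 2 ^ (c + 1) * X 3 ^ e -
      X 0 ^ a * X 1 ^ b * X 2 ^ c * X 3 ^ e := by
    rw [equation]; ring
  simp only [LinearMap.comp_apply, LinearMap.mulRight_apply, h, map_sub, haar_pow, haarCoeff]
  by_cases hc : a = e ∧ b = c
  · obtain ⟨rfl, rfl⟩ := hc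
    simp only [and_self, if_true]
    have h1 : a + 1 + b + 1 = (a + b + 1) + 1 := by ring
    have h2 : a + (b + 1) + 1 = (a + b + 1) + 1 := by ring
    rw [h1, h2, Nat.factorial_succ (a + b + 1), Nat.factorial_succ a, Nat.factorial_succ b]
    have h3 : ((a + b + 1).factorial : ℂ) ≠ 0 := by exact_mod_cast Nat.factorial_ne_zero _
    have h4 : (a : ℂ) + b + 1 + 1 ≠ 0 := by exact_mod_cast Nat.succ_ne_zero (a + b + 1)
    push_cast
    field_simp
    ring
  · have h1 : ¬(a + 1 = e + 1 ∧ b = c) := by simpa using hc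
    have h2 : ¬(a = e ∧ b + 1 = c + 1) := by simpa using hc
    simp [hc]

/-- This is the invariance under `derE` on one monomial: the two terms are balanced simultaneously
and have opposite signs. If `b = 0` or `e = 0`, the truncated exponent has coefficient zero and the
other term is not balanced. -/
lemma haarCoeff_raise (a b c e : ℕ) :
    (b : ℂ) * haarCoeff (a + 1) (b - 1) c e + e * haarCoeff a b (c + 1) (e - 1) = 0 := by
  rcases b with _ | b
  · simp [haarCoeff]
  rcases e with _ | e
  · simp [haarCoeff]
  simp only [haarCoeff, add_tsub_cancel_right, add_left_inj]
  split_ifs with h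
  · obtain ⟨rfl, rfl⟩ := h
    have h1 : a + (b + 1) + 1 = a + 1 + b + 1 := by ring
    rw [h1, Nat.factorial_succ a, Nat.factorial_succ b]
    push_cast
    ring
  · simp

lemma haarCoeff_lower (a b c e : ℕ) :
    (a : ℂ) * haarCoeff (a - 1) (b + 1) c e + c * haarCoeff a b (c - 1) (e + 1) = 0 := by
  rcases a with _ | a
  · simp [haarCoeff]
  rcases c with _ | c
  · simp [haarCoeff]
  simp only [haarCoeff, add_tsub_cancel_right, add_left_inj]
  split_ifs with h
  · obtain ⟨rfl, rfl⟩ := h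
    have h1 : a + (b + 1) + 1 = a + 1 + b + 1 := by ring
    rw [h1, Nat.factorial_succ a, Nat.factorial_succ b]
    push_cast
    ring
  · simp

lemma haar_derE (p : MvPolynomial (Fin 4) ℂ) : haar (derE p) = 0 := by
  refine linearMap_eq_zero_of_pow (φ := haar ∘ₗ derE.toLinearMap) (fun a b c e => ?_) p
  have h : (derE (X 0 ^ a * X 1 ^ b * X 2 ^ c * X 3 ^ e)) =
      (b : ℂ) • (X 0 ^ (a + 1) * X 1 ^ (b - 1) * X 2 ^ c * X 3 ^ e) +
      (e : ℂ) • (X 0 ^ a * X 1 ^ b * X 2 ^ (c + 1) * X 3 ^ (e - 1)) := by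
    simp only [derE, Derivation.leibniz, Derivation.leibniz_pow, mkDerivation_X, smul_eq_mul,
      nsmul_eq_mul, smul_eq_C_mul, map_natCast]
    simp
    ring
  simp only [LinearMap.comp_apply, Derivation.coeFn_coe, h,
    map_add, map_smul, haar_pow, smul_eq_mul]
  exact haarCoeff_raise a b c e

lemma haar_derF (p : MvPolynomial (Fin 4) ℂ) : haar (derF p) = 0 := by
  refine linearMap_eq_zero_of_pow (φ := haar ∘ₗ derF.toLinearMap) (fun a b c e => ?_) p
  have h : (derF (X 0 ^ a * X 1 ^ b * X 2 ^ c * X 3 ^ e)) =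
      (a : ℂ) • (X 0 ^ (a - 1) * X 1 ^ (b + 1) * X 2 ^ c * X 3 ^ e) +
      (c : ℂ) • (X 0 ^ a * X 1 ^ b * X 2 ^ (c - 1) * X 3 ^ (e + 1)) := by
    simp only [derF, Derivation.leibniz, Derivation.leibniz_pow, mkDerivation_X, smul_eq_mul,
      nsmul_eq_mul, smul_eq_C_mul, map_natCast]
    simp
    ring
  simp only [LinearMap.comp_apply, Derivation.coeFn_coe, h,
    map_add, map_smul, haar_pow, smul_eq_mul]
  exact haarCoeff_lower a b c e

lemma pow_pred_mul_natCast {R : Type*} [CommRing R] (x : R) (n : ℕ) :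
    (n : R) * (x ^ (n - 1) * x) = n * x ^ n := by
  rcases n with _ | n
  · simp
  · simp [pow_succ]

/-- Monomials are eigenvectors of `derH` of weight $a-b+c-e$, which is zero wherever `haarCoeff` is
not. -/
lemma haar_derH (p : MvPolynomial (Fin 4) ℂ) : haar (derH p) = 0 := by
  refine linearMap_eq_zero_of_pow (φ := haar ∘ₗ derH.toLinearMap) (fun a b c e => ?_) p
  have h : (derH (X 0 ^ a * X 1 ^ b * X 2 ^ c * X 3 ^ e)) =
      ((a : ℂ) - b + c - e) • (X 0 ^ a * X 1 ^ b * X 2 ^ c * X 3 ^ e) := by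
    simp only [derH, Derivation.leibniz, Derivation.leibniz_pow, mkDerivation_X, smul_eq_mul,
      nsmul_eq_mul, smul_eq_C_mul, map_natCast, map_add, map_sub]
    simp only [Matrix.cons_val]
    linear_combination (X 1 ^ b * X 2 ^ c * X 3 ^ e) * pow_pred_mul_natCast (X 0 : MvPolynomial (Fin 4) ℂ) a -
      (X 0 ^ a * X 2 ^ c * X 3 ^ e) * pow_pred_mul_natCast (X 1 : MvPolynomial (Fin 4) ℂ) b +
      (X 0 ^ a * X 1 ^ b * X 3 ^ e) * pow_pred_mul_natCast (X 2 : MvPolynomial (Fin 4) ℂ) c -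
      (X 0 ^ a * X 1 ^ b * X 2 ^ c) * pow_pred_mul_natCast (X 3 : MvPolynomial (Fin 4) ℂ) e
  simp only [LinearMap.comp_apply, Derivation.coeFn_coe, h,
    map_smul, haar_pow, smul_eq_mul, haarCoeff]
  split_ifs with h
  · obtain ⟨rfl, rfl⟩ := h
    ring
  · simp

lemma haar_one : haar 1 = 1 := by
  simpa [haarCoeff] using haar_pow 0 0 0 0

/-- A constant that is a divergence on `SL₂` vanishes. -/
lemma eq_zero_of_divergence_mem {c : ℂ} {p q r : MvPolynomial (Fin 4) ℂ}
    (h : C c - (derE p + derF q + derH r) ∈ Ideal.span {equation 1 1}) : c = 0 := by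
  obtain ⟨w, hw⟩ := Ideal.mem_span_singleton'.mp h
  have := congrArg haar hw
  rw [haar_equation_mul, map_sub, map_add, map_add, haar_derE, haar_derF, haar_derH,
    ← mul_one (C c), ← smul_eq_C_mul, map_smul, haar_one] at this
  simpa using this.symm

end ExoticSphere

end

noncomputable section

namespace ExoticSphere

open MvPolynomial

/-! ### Derivations of a finitely generated field extension of `ℂ` -/

variable {K : Type*} [Field K] [Algebra ℂ K]

/-- Every element of `K` is a quotient of elements of the subalgebra `B`. -/
def HasFractions (B : Subalgebra ℂ K) : Prop :=
  ∀ z : K, ∃ b ∈ B, b ≠ 0 ∧ z * b ∈ B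

/-- The subalgebra `L` of the field `K` is a localization of the subalgebra `B`. -/
def IsLocalizationIn (B L : Subalgebra ℂ K) : Prop :=
  B ≤ L ∧ ∀ z ∈ L, ∃ b ∈ B, b ≠ 0 ∧ b⁻¹ ∈ L ∧ z * b ∈ B

lemma HasFractions.isFractionRing {B : Subalgebra ℂ K} (h : HasFractions B) :
    IsFractionRing B K where
  map_units y := by
    exact isUnit_iff_ne_zero.mpr (by simp)
  surj z := by
    obtain ⟨b, hb, hb0, hzb⟩ := h z
    refine ⟨(⟨_, hzb⟩, ⟨⟨b, hb⟩, ?_⟩), rfl⟩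
    rw [mem_nonZeroDivisors_iff_ne_zero]
    exact fun h => hb0 (congrArg Subtype.val h)
  exists_of_eq := by
    intro x y hxy
    exact ⟨1, by simpa using hxy⟩

lemma HasFractions.of_isLocalizationIn {B C L : Subalgebra ℂ K} (h : HasFractions B)
    (hBL : B ≤ L) (hC : IsLocalizationIn C L) : HasFractions C := by
  intro z
  obtain ⟨b, hb, hb0, hzb⟩ := h z
  obtain ⟨c, hc, hc0, -, hbc⟩ := hC.2 b (hBL hb)
  obtain ⟨c', hc', hc0', -, hbc'⟩ := hC.2 (z * b) (hBL hzb)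
  refine ⟨b * c * c', C.mul_mem hbc hc', mul_ne_zero (mul_ne_zero hb0 hc0) hc0', ?_⟩
  have : z * (b * c * c') = (z * b * c') * c := by ring
  rw [this]
  exact C.mul_mem hbc' hc

/-- A derivation of $K$ is the same as a homomorphism $z \mapsto z + \varepsilon D(z)$ to the dual
numbers. The hypothesis `hw` says that the relations among the generators persist to first order, so
the prescribed values define such a homomorphism on the subalgebra. -/
lemma exists_derivation {σ : Type*} (g : MvPolynomial σ ℂ →ₐ[ℂ] K) (hg : HasFractions g.range)
    (w : σ → K)
    (hw : ∀ p, g p = 0 →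
      aeval (fun i => (TrivSqZeroExt.inl (g (X i)) + TrivSqZeroExt.inr (w i) :
        TrivSqZeroExt K K)) p = 0) :
    ∃ D : Derivation ℂ K K, ∀ i, D (g (X i)) = w i := by
  have := hg.isFractionRing
  set φ : MvPolynomial σ ℂ →ₐ[ℂ] TrivSqZeroExt K K :=
    aeval (fun i => (TrivSqZeroExt.inl (g (X i)) + TrivSqZeroExt.inr (w i))) with hφ
  have hfst : ∀ p, (φ p).fst = g p := by
    intro p
    have : (TrivSqZeroExt.fstHom ℂ K K).comp φ = g := by
      ext i
      simp [hφ]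
    exact DFunLike.congr_fun this p
  let ψ : g.range →ₐ[ℂ] TrivSqZeroExt K K :=
    AlgHom.liftOfSurjective g.rangeRestrict g.rangeRestrict_surjective φ (by
      intro p hp
      refine hw p ?_
      exact congrArg Subtype.val hp)
  have hψ : ∀ p, ψ (g.rangeRestrict p) = φ p := fun p =>
    AlgHom.liftOfSurjective_apply _ _ _ _ p
  have hψfst : ∀ b : g.range, (ψ b).fst = b := by
    intro b
    obtain ⟨p, rfl⟩ := g.rangeRestrict_surjective b
    rw [hψ, hfst]; rfl
  -- The homomorphism extends to fractions because a dual number with nonzero constant part is a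
  -- unit.
  let Φ : K →ₐ[ℂ] TrivSqZeroExt K K :=
    IsLocalization.liftAlgHom (M := nonZeroDivisors g.range) (S := K) (f := ψ) (by
      intro y
      rw [TrivSqZeroExt.isUnit_iff_isUnit_fst, hψfst, isUnit_iff_ne_zero]
      simp)
  have hΦ : ∀ b : g.range, Φ b = ψ b := fun b => IsLocalization.lift_eq _ b
  have hΦfst : ∀ z, (Φ z).fst = z := by
    intro z
    obtain ⟨b, hb, hb0, hzb⟩ := hg z
    have h1 := hΦ ⟨b, hb⟩
    have h2 := hΦ ⟨_, hzb⟩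
    have h3 : (Φ (z * b)).fst = z * b := by
      have := congrArg TrivSqZeroExt.fst h2
      rwa [hψfst] at this
    have h4 : (Φ b).fst = b := by
      have := congrArg TrivSqZeroExt.fst h1
      rwa [hψfst] at this
    rw [map_mul, TrivSqZeroExt.fst_mul, h4] at h3
    exact mul_right_cancel₀ hb0 h3
  refine ⟨Derivation.mk' ((TrivSqZeroExt.sndHom K K).restrictScalars ℂ ∘ₗ Φ.toLinearMap) ?_, ?_⟩
  · intro a b
    simp [TrivSqZeroExt.snd_mul, hΦfst, mul_comm b]
  · intro i
    have h1 := hΦ (g.rangeRestrict (X i))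
    rw [hψ] at h1
    have h2 : Φ (g (X i)) = φ (X i) := h1
    simp [h2, hφ]

lemma derivation_aeval {σ : Type*} [Fintype σ] (D : Derivation ℂ K K) (z : σ → K)
    (p : MvPolynomial σ ℂ) :
    D (aeval z p) = ∑ i, aeval z (pderiv i p) * D (z i) := by
  classical
  induction p using MvPolynomial.induction_on with
  | C a => simp
  | add p q hp hq => simp only [map_add, hp, hq, add_mul, Finset.sum_add_distrib]
  | mul_X p j hp =>
    simp only [map_mul, Derivation.leibniz, aeval_X, hp, pderiv_X, smul_eq_mul, map_add, add_mul,
      Finset.sum_add_distrib]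
    congr 1
    · rw [Finset.sum_eq_single j]
      · simp
      · intro i _ hi
        simp [hi.symm]
      · simp
    · rw [Finset.mul_sum]
      exact Finset.sum_congr rfl fun i _ => by ring

lemma derivation_ext_of_hasFractions {B : Subalgebra ℂ K} (hB : HasFractions B)
    {D D' : Derivation ℂ K K} (h : ∀ b ∈ B, D b = D' b) : D = D' := by
  ext z
  obtain ⟨b, hb, hb0, hzb⟩ := hB z
  have h1 := h _ hzb
  simp only [Derivation.leibniz, smul_eq_mul, h b hb] at h1
  exact mul_left_cancel₀ hb0 (add_left_cancel h1)

lemma derivation_ext_of_generators {σ : Type*} [Fintype σ] (z : σ → K)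
    (hB : HasFractions (aeval z : MvPolynomial σ ℂ →ₐ[ℂ] K).range)
    {D D' : Derivation ℂ K K} (h : ∀ i, D (z i) = D' (z i)) : D = D' := by
  refine derivation_ext_of_hasFractions hB ?_
  rintro _ ⟨p, rfl⟩
  simp only [AlgHom.toRingHom_eq_coe, RingHom.coe_coe]
  rw [derivation_aeval, derivation_aeval]
  simp [h]

/-- Regularity of a vector field on a chart needs checking only on coordinates: the quotient rule
introduces no denominators beyond those already inverted in `L`. -/
lemma IsLocalizationIn.derivation_mem {σ : Type*} [Fintype σ] {z : σ → K} {L : Subalgebra ℂ K}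
    (hL : IsLocalizationIn (aeval z : MvPolynomial σ ℂ →ₐ[ℂ] K).range L)
    {D : Derivation ℂ K K} (hD : ∀ i, D (z i) ∈ L) {a : K} (ha : a ∈ L) : D a ∈ L := by
  have h1 : ∀ b ∈ (aeval z : MvPolynomial σ ℂ →ₐ[ℂ] K).range, D b ∈ L := by
    rintro _ ⟨p, rfl⟩
    simp only [AlgHom.toRingHom_eq_coe, RingHom.coe_coe]
    rw [derivation_aeval]
    exact L.sum_mem fun i _ => L.mul_mem (hL.1 ⟨_, rfl⟩) (hD i)
  obtain ⟨b, hb, hb0, hbL, hab⟩ := hL.2 a ha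
  have h2 : D a = b⁻¹ * (D (a * b) - a * D b) := by
    simp only [Derivation.leibniz, smul_eq_mul]
    field_simp
    ring
  rw [h2]
  exact L.mul_mem hbL (L.sub_mem (h1 _ hab) (L.mul_mem ha (h1 _ hb)))

/-- Algebraically independent generators of a field have prescribed derivatives. -/
lemma exists_derivation_of_algebraicIndependent {σ : Type*} {z : σ → K}
    (hz : AlgebraicIndependent ℂ z)
    (hB : HasFractions (aeval z : MvPolynomial σ ℂ →ₐ[ℂ] K).range) (w : σ → K) :
    ∃ D : Derivation ℂ K K, ∀ i, D (z i) = w i := by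
  obtain ⟨D, hD⟩ := exists_derivation (aeval z) hB w (by
    intro p hp
    have : p = 0 := hz (by simpa using hp)
    simp [this])
  exact ⟨D, fun i => by simpa using hD i⟩

end ExoticSphere

end

noncomputable section

namespace ExoticSphere

open MvPolynomial

/-! ### Divergence of derivations on `SL₂` -/

section

variable {K : Type*} [Field K] [Algebra ℂ K]

lemma derivation_aeval_eq_mkDerivation {σ : Type*} {z : σ → K} {D : Derivation ℂ K K}
    {w : σ → MvPolynomial σ ℂ} (hD : ∀ i, D (z i) = aeval z (w i)) (p : MvPolynomial σ ℂ) :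
    D (aeval z p) = aeval z (mkDerivation ℂ w p) := by
  induction p using MvPolynomial.induction_on with
  | C a => simp
  | add p q hp hq => simp only [map_add, hp, hq]
  | mul_X p j hp =>
    simp only [map_mul, Derivation.leibniz, aeval_X, hp, smul_eq_mul, map_add, mkDerivation_X, hD]

/-- The entries `z` of a matrix in `SL₂(K)` are generic: they satisfy only the polynomial relations
that follow from `det = 1`, and generate the field `K`. -/
structure IsGenericSL2 (z : Fin 4 → K) : Prop where
  ker : ∀ p : MvPolynomial (Fin 4) ℂ, aeval z p = 0 ↔ p ∈ Ideal.span {equation 1 1}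
  frac : HasFractions (aeval z : MvPolynomial (Fin 4) ℂ →ₐ[ℂ] K).range

namespace IsGenericSL2

variable {z : Fin 4 → K}

lemma det_eq_one (hz : IsGenericSL2 z) : z 0 * z 3 - z 1 * z 2 = 1 := by
  have := (hz.ker _).mpr (Ideal.mem_span_singleton_self _)
  simp only [equation, map_sub, map_mul, aeval_X, map_one, pow_one] at this
  exact sub_eq_zero.mp this

lemma map_equation_mul (hz : IsGenericSL2 z) {R : Type*} [CommRing R] [Algebra ℂ R] {w : Fin 4 → R}
    (hw : w 0 * w 3 - w 1 * w 2 = 1) {p : MvPolynomial (Fin 4) ℂ} (hp : aeval z p = 0) :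
    aeval w p = 0 := by
  obtain ⟨q, rfl⟩ := Ideal.mem_span_singleton'.mp ((hz.ker p).mp hp)
  simp only [equation, map_sub, map_mul, aeval_X, map_one, pow_one, hw, sub_self,
    mul_zero]

/-- The condition `hw` is tangency to $\mathrm{SL}_2$: over the dual numbers, $z+\varepsilon w$
still has determinant $1$. -/
lemma exists_derivation (hz : IsGenericSL2 z) (w : Fin 4 → K)
    (hw : w 0 * z 3 + z 0 * w 3 - w 1 * z 2 - z 1 * w 2 = 0) :
    ∃ D : Derivation ℂ K K, ∀ i, D (z i) = w i := by
  obtain ⟨D, hD⟩ := ExoticSphere.exists_derivation (aeval z) hz.frac w (by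
    intro p hp
    refine hz.map_equation_mul ?_ hp
    ext
    · simpa using hz.det_eq_one
    · simp
      linear_combination hw)
  exact ⟨D, fun i => by simpa using hD i⟩

end IsGenericSL2

/-- A basis of the derivations of the field `K` of rational functions on `SL₂` that consists of left
invariant vector fields. -/
structure InvariantFrame (z : Fin 4 → K) where
  e : Derivation ℂ K K
  f : Derivation ℂ K K
  h : Derivation ℂ K K
  e_apply : ∀ i, e (z i) = ![0, z 0, 0, z 2] i
  f_apply : ∀ i, f (z i) = ![z 1, 0, z 3, 0] i
  h_apply : ∀ i, h (z i) = ![z 0, -z 1, z 2, -z 3] i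

lemma IsGenericSL2.nonempty_frame {z : Fin 4 → K} (hz : IsGenericSL2 z) :
    Nonempty (InvariantFrame z) := by
  obtain ⟨e, he⟩ := hz.exists_derivation ![0, z 0, 0, z 2] (by simp)
  obtain ⟨f, hf⟩ := hz.exists_derivation ![z 1, 0, z 3, 0] (by simp)
  obtain ⟨h, hh⟩ := hz.exists_derivation ![z 0, -z 1, z 2, -z 3] (by simp)
  exact ⟨⟨e, f, h, he, hf, hh⟩⟩

namespace InvariantFrame

variable {z : Fin 4 → K} (F : InvariantFrame z)

lemma e_aeval (p : MvPolynomial (Fin 4) ℂ) : F.e (aeval z p) = aeval z (derE p) :=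
  derivation_aeval_eq_mkDerivation (fun i => by rw [F.e_apply]; fin_cases i <;> simp) p

lemma f_aeval (p : MvPolynomial (Fin 4) ℂ) : F.f (aeval z p) = aeval z (derF p) :=
  derivation_aeval_eq_mkDerivation (fun i => by rw [F.f_apply]; fin_cases i <;> simp) p

lemma h_aeval (p : MvPolynomial (Fin 4) ℂ) : F.h (aeval z p) = aeval z (derH p) :=
  derivation_aeval_eq_mkDerivation (fun i => by rw [F.h_apply]; fin_cases i <;> simp) p

lemma lie_e_f (hz : IsGenericSL2 z) (a : K) : F.e (F.f a) - F.f (F.e a) = F.h a := by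
  rw [← Derivation.commutator_apply]
  congr 1
  refine derivation_ext_of_generators z hz.frac fun i => ?_
  rw [Derivation.commutator_apply, F.e_apply, F.f_apply, F.h_apply]
  fin_cases i <;> simp [F.e_apply, F.f_apply]

lemma lie_h_e (hz : IsGenericSL2 z) (a : K) : F.h (F.e a) - F.e (F.h a) = 2 * F.e a := by
  have : ⁅F.h, F.e⁆ = (2 : K) • F.e := by
    refine derivation_ext_of_generators z hz.frac fun i => ?_
    rw [Derivation.commutator_apply, Derivation.smul_apply, F.e_apply, F.h_apply]
    fin_cases i <;> simp [F.e_apply, F.h_apply] <;> ring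
  rw [← Derivation.commutator_apply, this]; rfl

lemma lie_h_f (hz : IsGenericSL2 z) (a : K) : F.h (F.f a) - F.f (F.h a) = -2 * F.f a := by
  have : ⁅F.h, F.f⁆ = (-2 : K) • F.f := by
    refine derivation_ext_of_generators z hz.frac fun i => ?_
    rw [Derivation.commutator_apply, Derivation.smul_apply, F.f_apply, F.h_apply]
    fin_cases i <;> simp [F.f_apply, F.h_apply] <;> ring
  rw [← Derivation.commutator_apply, this]; rfl

/-- The expansion of a derivation `D` in the frame: its coefficients are the entries
of `g⁻¹ D(g)`. -/
lemma expand (hz : IsGenericSL2 z) (D : Derivation ℂ K K) (a : K) :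
    D a = (z 3 * D (z 1) - z 1 * D (z 3)) * F.e a + (z 0 * D (z 2) - z 2 * D (z 0)) * F.f a +
      (z 3 * D (z 0) - z 1 * D (z 2)) * F.h a := by
  have hdet := hz.det_eq_one
  -- Differentiating the determinant shows that $g^{-1}D(g)$ has trace zero. One diagonal entry thus
  -- determines the other, and three coefficients suffice.
  have hD : D (z 0) * z 3 + z 0 * D (z 3) - D (z 1) * z 2 - z 1 * D (z 2) = 0 := by
    have := congrArg D hdet
    simp only [map_sub, Derivation.leibniz, smul_eq_mul, Derivation.map_one_eq_zero] at this
    linear_combination this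
  have : D = (z 3 * D (z 1) - z 1 * D (z 3)) • F.e + (z 0 * D (z 2) - z 2 * D (z 0)) • F.f +
      (z 3 * D (z 0) - z 1 * D (z 2)) • F.h := by
    refine derivation_ext_of_generators z hz.frac fun i => ?_
    simp only [Derivation.add_apply, Derivation.smul_apply, F.e_apply, F.f_apply, F.h_apply,
      smul_eq_mul]
    fin_cases i
    · simp
      linear_combination (-D (z 0)) * hdet
    · simp
      linear_combination (-D (z 1)) * hdet + z 1 * hD
    · simp
      linear_combination (-D (z 2)) * hdet
    · simp
      linear_combination (-D (z 3)) * hdet + z 3 * hD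
  conv_lhs => rw [this]
  rfl

/-- The Jacobian determinant with respect to the frame. -/
def jac (x y t : K) : K :=
  F.e x * (F.f y * F.h t - F.h y * F.f t) - F.e y * (F.f x * F.h t - F.h x * F.f t) +
    F.e t * (F.f x * F.h y - F.h x * F.f y)

/-- The divergence of a derivation for which `x, y, t` are eigenvectors. -/
lemma divergence_eq (hz : IsGenericSL2 z) {E : Derivation ℂ K K} {a b c x y t wx wy wt : K}
    (hE : ∀ r, E r = a * F.e r + b * F.f r + c * F.h r)
    (hx : E x = wx * x) (hy : E y = wy * y) (ht : E t = wt * t)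
    (hwx : ∀ D : Derivation ℂ K K, D wx = 0) (hwy : ∀ D : Derivation ℂ K K, D wy = 0)
    (hwt : ∀ D : Derivation ℂ K K, D wt = 0)
    (hJ : F.jac x y t ≠ 0) (hEJ : E (F.jac x y t) = 0) :
    F.e a + F.f b + F.h c = wx + wy + wt := by
  -- Differentiate $E r = w r$ along each frame field and commute that field past $E$. The
  -- undifferentiated `a`, `b`, `c` terms come from the brackets of $\mathfrak{sl}_2$.
  have row : ∀ r w, E r = w * r → (∀ D : Derivation ℂ K K, D w = 0) →
      (w * F.e r = F.e a * F.e r + F.e b * F.f r + F.e c * F.h r + E (F.e r) + b * F.h r -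
          2 * c * F.e r) ∧
      (w * F.f r = F.f a * F.e r + F.f b * F.f r + F.f c * F.h r + E (F.f r) - a * F.h r +
          2 * c * F.f r) ∧
      (w * F.h r = F.h a * F.e r + F.h b * F.f r + F.h c * F.h r + E (F.h r) + 2 * a * F.e r -
          2 * b * F.f r) := by
    intro r w hr hw
    have key : ∀ D : Derivation ℂ K K, w * D r = D a * F.e r + a * D (F.e r) +
        (D b * F.f r + b * D (F.f r)) + (D c * F.h r + c * D (F.h r)) := by
      intro D
      have h1 := congrArg D hr
      rw [hE r] at h1
      simp only [map_add, Derivation.leibniz, smul_eq_mul, hw D] at h1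
      linear_combination -h1
    refine ⟨?_, ?_, ?_⟩
    · rw [hE (F.e r)]
      linear_combination key F.e + b * F.lie_e_f hz r - c * F.lie_h_e hz r
    · rw [hE (F.f r)]
      linear_combination key F.f - a * F.lie_e_f hz r - c * F.lie_h_f hz r
    · rw [hE (F.h r)]
      linear_combination key F.h + a * F.lie_h_e hz r + b * F.lie_h_f hz r
  obtain ⟨x1, x2, x3⟩ := row x wx hx hwx
  obtain ⟨y1, y2, y3⟩ := row y wy hy hwy
  obtain ⟨t1, t2, t3⟩ := row t wt ht hwt
  simp only [jac, map_add, map_sub, Derivation.leibniz, smul_eq_mul] at hEJ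
  refine mul_left_cancel₀ hJ ?_
  rw [jac]
  -- The multipliers are the signed cofactors of the Jacobian matrix. The bracket terms act on it by
  -- a trace-free matrix and so cancel, which leaves $E(J) = (w_x+w_y+w_t-\operatorname{div}E)\,J$.
  linear_combination -(F.f y * F.h t - F.h y * F.f t) * x1 + (F.e y * F.h t - F.h y * F.e t) * x2 -
    (F.e y * F.f t - F.f y * F.e t) * x3 + (F.f x * F.h t - F.h x * F.f t) * y1 -
    (F.e x * F.h t - F.h x * F.e t) * y2 + (F.e x * F.f t - F.f x * F.e t) * y3 -
    (F.f x * F.h y - F.h x * F.f y) * t1 + (F.e x * F.h y - F.h x * F.e y) * t2 -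
    (F.e x * F.f y - F.f x * F.e y) * t3 - hEJ

end InvariantFrame

/-- A unit is constant along the unipotent flow `z + s w` on `SL₂`. -/
lemma IsGenericSL2.derivation_unipotent_unit {z : Fin 4 → K} (hz : IsGenericSL2 z)
    {D : Derivation ℂ K K} {w : Fin 4 → K} (hD : ∀ i, D (z i) = w i)
    (h1 : z 0 * w 3 + w 0 * z 3 - z 1 * w 2 - w 1 * z 2 = 0) (h2 : w 0 * w 3 = w 1 * w 2) {J : K}
    (hJ : J ∈ (aeval z : MvPolynomial (Fin 4) ℂ →ₐ[ℂ] K).range)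
    (hJ' : J⁻¹ ∈ (aeval z : MvPolynomial (Fin 4) ℂ →ₐ[ℂ] K).range) : D J = 0 := by
  by_cases hJ0 : J = 0
  · simp [hJ0]
  obtain ⟨p, hp⟩ := hJ
  obtain ⟨q, hq⟩ := hJ'
  simp only [AlgHom.toRingHom_eq_coe, RingHom.coe_coe] at hp hq
  -- `h1` and `h2` are the coefficients of $s$ and $s^2$ in $\det(z+sw)=1$, so the flow gives a
  -- homomorphism to $K[s]$. A unit maps to a unit of $K[s]$, that is, to a constant, and its
  -- coefficient of $s$ is $D(J)$.
  let φ : MvPolynomial (Fin 4) ℂ →ₐ[ℂ] Polynomial K :=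
    aeval fun i => Polynomial.C (z i) + Polynomial.X * Polynomial.C (w i)
  have hφ : ∀ r, aeval z r = 0 → φ r = 0 := by
    refine fun r hr => hz.map_equation_mul ?_ hr
    have h3 := congrArg (Polynomial.C (R := K)) h1
    have h4 := congrArg (Polynomial.C (R := K)) h2
    have h5 := congrArg (Polynomial.C (R := K)) hz.det_eq_one
    simp only [map_add, map_sub, map_mul, map_zero, map_one] at h3 h4 h5
    linear_combination h5 + Polynomial.X * h3 + Polynomial.X ^ 2 * h4
  have hcoeff : ∀ r, (φ r).coeff 0 = aeval z r ∧ (φ r).coeff 1 = D (aeval z r) := by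
    intro r
    induction r using MvPolynomial.induction_on with
    | C a =>
      have : φ (C a) = Polynomial.C (algebraMap ℂ K a) := by
        simp only [φ, algHom_C]; rfl
      rw [this]
      simp [Polynomial.coeff_C]
    | add p q hp hq => simp [hp, hq]
    | mul_X p j hp =>
      have hX : φ (X j) = Polynomial.C (z j) + Polynomial.X * Polynomial.C (w j) := by
        simp [φ]
      have hc0 : (φ (X j)).coeff 0 = z j := by simp [hX]
      have hc1 : (φ (X j)).coeff 1 = w j := by simp [hX, Polynomial.coeff_C]
      rw [map_mul, Polynomial.mul_coeff_zero, Polynomial.mul_coeff_one, hc0, hc1, hp.1, hp.2]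
      simp only [map_mul, aeval_X, Derivation.leibniz, hD, smul_eq_mul]
      exact ⟨trivial, by ring⟩
  have hpq : φ p * φ q = 1 := by
    have := hφ (p * q - 1) (by rw [map_sub, map_mul, hp, hq, map_one, mul_inv_cancel₀ hJ0, sub_self])
    rw [map_sub, map_mul, map_one] at this
    exact sub_eq_zero.mp this
  obtain ⟨r, -, hr⟩ := Polynomial.isUnit_iff.mp (IsUnit.of_mul_eq_one _ hpq)
  rw [← hp, ← (hcoeff p).2, ← hr]
  simp

/-- The nilpotent fields $e$ and $f$ generate unipotent flows and kill units. Their bracket $h$ then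
does so too, and the three fields span all derivations. -/
lemma IsGenericSL2.derivation_unit {z : Fin 4 → K} (hz : IsGenericSL2 z) {J : K}
    (hJ : J ∈ (aeval z : MvPolynomial (Fin 4) ℂ →ₐ[ℂ] K).range)
    (hJ' : J⁻¹ ∈ (aeval z : MvPolynomial (Fin 4) ℂ →ₐ[ℂ] K).range) (D : Derivation ℂ K K) :
    D J = 0 := by
  obtain ⟨F⟩ := hz.nonempty_frame
  have he : F.e J = 0 :=
    hz.derivation_unipotent_unit F.e_apply (by simp) (by simp) hJ hJ'
  have hf : F.f J = 0 :=
    hz.derivation_unipotent_unit F.f_apply (by simp) (by simp) hJ hJ'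
  have hh : F.h J = 0 := by rw [← F.lie_e_f hz, he, hf]; simp
  rw [F.expand hz D, he, hf, hh]
  ring

end
end ExoticSphere

end

noncomputable section

namespace ExoticSphere

open MvPolynomial

/-! ### Homogeneous coordinates on `SL₂` -/

section

variable {K : Type*} [Field K] [Algebra ℂ K]

/-- The subalgebra generated by the family `z`, as the range of an evaluation map. -/
abbrev polyRange {n : ℕ} (z : Fin n → K) : Subalgebra ℂ K :=
  (aeval z : MvPolynomial (Fin n) ℂ →ₐ[ℂ] K).range

lemma mem_polyRange {n : ℕ} (z : Fin n → K) (i : Fin n) : z i ∈ polyRange z :=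
  ⟨X i, by simp⟩

/-- The elements `r` and `r'` differ by a homogeneous rational function of degree `k`
in `x` and `y`. -/
def DiffHomogeneous (x y : K) (k : ℤ) (r r' : K) : Prop :=
  ∃ (a b : ℕ) (p q : MvPolynomial (Fin 2) ℂ), p.IsHomogeneous a ∧ q.IsHomogeneous b ∧ q ≠ 0 ∧
    (a : ℤ) - (b : ℤ) = k ∧ aeval ![x, y] q * (r - r') = aeval ![x, y] p

lemma aeval_pair_ne_zero {x y t : K} (h : AlgebraicIndependent ℂ ![x, y, t])
    {q : MvPolynomial (Fin 2) ℂ} (hq : q ≠ 0) : aeval ![x, y] q ≠ 0 := by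
  have h2 : AlgebraicIndependent ℂ ![x, y] := by
    have := h.comp (Fin.castSucc : Fin 2 → Fin 3) (Fin.castSucc_injective 2)
    convert this using 1
    ext i
    fin_cases i <;> rfl
  intro h0
  exact hq (h2 (by simpa using h0))

lemma derivation_aeval_of_isHomogeneous {x y : K} {E : Derivation ℂ K K} (hx : E x = x)
    (hy : E y = y) {p : MvPolynomial (Fin 2) ℂ} {a : ℕ} (hp : p.IsHomogeneous a) :
    E (aeval ![x, y] p) = a * aeval ![x, y] p := by
  have h := congrArg (aeval (R := ℂ) ![x, y]) hp.sum_X_mul_pderiv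
  rw [derivation_aeval, Fin.sum_univ_two]
  rw [Fin.sum_univ_two] at h
  simp only [map_add, map_mul, aeval_X, nsmul_eq_mul, map_natCast, Matrix.cons_val_zero,
    Matrix.cons_val_one] at h ⊢
  rw [hx, hy]
  linear_combination h

/-- By Euler's identity $E$ multiplies a homogeneous rational function of degree $k$ by $k$. This is
why the local Euler fields agree on overlaps. -/
lemma DiffHomogeneous.euler {x y t r r' : K} {k : ℤ} (h : DiffHomogeneous x y k r r')
    (hxyt : AlgebraicIndependent ℂ ![x, y, t]) {E : Derivation ℂ K K} (hx : E x = x)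
    (hy : E y = y) (hr' : E r' = k * r') : E r = k * r := by
  obtain ⟨a, b, p, q, hp, hq, hq0, hab, he⟩ := h
  have hq1 := aeval_pair_ne_zero hxyt hq0
  have h1 := congrArg E he
  simp only [Derivation.leibniz, smul_eq_mul, map_sub, derivation_aeval_of_isHomogeneous hx hy hp,
    derivation_aeval_of_isHomogeneous hx hy hq] at h1
  have h2 : (a : K) - b = k := by exact_mod_cast congrArg (Int.cast : ℤ → K) hab
  refine mul_left_cancel₀ hq1 ?_
  linear_combination h1 + aeval ![x, y] q * hr' - a * he + aeval ![x, y] q * (r - r') * h2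

/-- The differential of $r-r'$ is a combination of $dx$ and $dy$, so it does not change $dx\wedge
dy\wedge dr$. -/
lemma DiffHomogeneous.jac_eq {x y t r r' : K} {k : ℤ} (h : DiffHomogeneous x y k r r')
    (hxyt : AlgebraicIndependent ℂ ![x, y, t]) {z : Fin 4 → K} (F : InvariantFrame z) :
    F.jac x y r = F.jac x y r' := by
  obtain ⟨a, b, p, q, hp, hq, hq0, hab, he⟩ := h
  have hq1 := aeval_pair_ne_zero hxyt hq0
  have key : ∃ α β : K, ∀ D : Derivation ℂ K K,
      aeval ![x, y] q * (D r - D r') = α * D x + β * D y := by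
    refine ⟨aeval ![x, y] (pderiv 0 p) - (r - r') * aeval ![x, y] (pderiv 0 q),
      aeval ![x, y] (pderiv 1 p) - (r - r') * aeval ![x, y] (pderiv 1 q), fun D => ?_⟩
    have h1 := congrArg D he
    simp only [Derivation.leibniz, smul_eq_mul, map_sub, derivation_aeval, Fin.sum_univ_two,
      Matrix.cons_val_zero, Matrix.cons_val_one] at h1
    linear_combination h1
  obtain ⟨α, β, hD⟩ := key
  refine mul_left_cancel₀ hq1 ?_
  simp only [InvariantFrame.jac]
  linear_combination (F.f x * F.h y - F.h x * F.f y) * hD F.e -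
    (F.e x * F.h y - F.h x * F.e y) * hD F.f + (F.e x * F.f y - F.f x * F.e y) * hD F.h

/-- The Jacobian determinant of a local coordinate system on `SL₂` is invertible. -/
lemma InvariantFrame.jac_mem_and_inv_mem {z : Fin 4 → K} (hz : IsGenericSL2 z)
    (F : InvariantFrame z) {L : Subalgebra ℂ K} {x y t : K} (hzL : IsLocalizationIn (polyRange z) L)
    (hxyt : AlgebraicIndependent ℂ ![x, y, t])
    (hL : IsLocalizationIn (polyRange ![x, y, t]) L) :
    F.jac x y t ∈ L ∧ F.jac x y t ≠ 0 ∧ (F.jac x y t)⁻¹ ∈ L := by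
  have hfrac : HasFractions (polyRange ![x, y, t]) := hz.frac.of_isLocalizationIn hzL.1 hL
  have hzmem : ∀ i, z i ∈ L := fun i => hzL.1 (mem_polyRange z i)
  have hxm : x ∈ L := hL.1 (mem_polyRange ![x, y, t] 0)
  have hym : y ∈ L := hL.1 (mem_polyRange ![x, y, t] 1)
  have htm : t ∈ L := hL.1 (mem_polyRange ![x, y, t] 2)
  have he : ∀ {a}, a ∈ L → F.e a ∈ L := fun ha => hzL.derivation_mem (fun i => by
    rw [F.e_apply]; fin_cases i <;> simp [hzmem]) ha
  have hf : ∀ {a}, a ∈ L → F.f a ∈ L := fun ha => hzL.derivation_mem (fun i => by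
    rw [F.f_apply]; fin_cases i <;> simp [hzmem]) ha
  have hh : ∀ {a}, a ∈ L → F.h a ∈ L := fun ha => hzL.derivation_mem (fun i => by
    rw [F.h_apply]; fin_cases i <;> simp [hzmem]) ha
  -- The coordinate fields $\partial_x,\partial_y,\partial_t$ preserve `L`. Their coefficients in
  -- the invariant frame form a matrix over `L` inverse to the Jacobian matrix.
  have key : ∀ i : Fin 3, ∃ a ∈ L, ∃ b ∈ L, ∃ c ∈ L,
      ∀ j, a * F.e (![x, y, t] j) + b * F.f (![x, y, t] j) + c * F.h (![x, y, t] j) =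
        if j = i then 1 else 0 := by
    intro i
    obtain ⟨D, hD⟩ := exists_derivation_of_algebraicIndependent hxyt hfrac
      (fun j => if j = i then 1 else 0)
    have hDL : ∀ j, D (z j) ∈ L := fun j => hL.derivation_mem (fun k => by
      rw [hD]; split_ifs
      · exact L.one_mem
      · exact L.zero_mem) (hzmem j)
    refine ⟨_, ?_, _, ?_, _, ?_, fun j => (F.expand hz D _).symm.trans (hD j)⟩
    all_goals exact L.sub_mem (L.mul_mem (hzmem _) (hDL _)) (L.mul_mem (hzmem _) (hDL _))
  obtain ⟨a0, ha0, b0, hb0, c0, hc0, h0⟩ := key 0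
  obtain ⟨a1, ha1, b1, hb1, c1, hc1, h1⟩ := key 1
  obtain ⟨a2, ha2, b2, hb2, c2, hc2, h2⟩ := key 2
  have hmul : (!![a0, b0, c0; a1, b1, c1; a2, b2, c2] : Matrix (Fin 3) (Fin 3) K) *
      !![F.e x, F.e y, F.e t; F.f x, F.f y, F.f t; F.h x, F.h y, F.h t] = 1 := by
    ext i j
    fin_cases i
    · have := h0 j
      fin_cases j <;> simpa [Matrix.mul_apply, Fin.sum_univ_three] using this
    · have := h1 j
      fin_cases j <;> simpa [Matrix.mul_apply, Fin.sum_univ_three] using this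
    · have := h2 j
      fin_cases j <;> simpa [Matrix.mul_apply, Fin.sum_univ_three] using this
  have hdet := congrArg Matrix.det hmul
  rw [Matrix.det_mul, Matrix.det_one] at hdet
  have hjac : (!![F.e x, F.e y, F.e t; F.f x, F.f y, F.f t; F.h x, F.h y, F.h t] :
      Matrix (Fin 3) (Fin 3) K).det = F.jac x y t := by
    rw [Matrix.det_fin_three, InvariantFrame.jac]
    simp
    ring
  rw [hjac] at hdet
  refine ⟨?_, right_ne_zero_of_mul_eq_one hdet, ?_⟩
  · rw [InvariantFrame.jac]
    refine L.add_mem (L.sub_mem ?_ ?_) ?_ <;>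
    refine L.mul_mem (he ?_) (L.sub_mem (L.mul_mem (hf ?_) (hh ?_)) (L.mul_mem (hh ?_) (hf ?_))) <;>
    assumption
  · rw [← eq_inv_of_mul_eq_one_left hdet]
    have hM : ∀ i j, (!![a0, b0, c0; a1, b1, c1; a2, b2, c2] : Matrix (Fin 3) (Fin 3) K) i j ∈ L := by
      intro i j
      fin_cases i <;> fin_cases j <;> assumption
    rw [Matrix.det_fin_three]
    refine L.sub_mem (L.add_mem (L.add_mem (L.sub_mem (L.sub_mem ?_ ?_) ?_) ?_) ?_) ?_ <;>
    exact L.mul_mem (L.mul_mem (hM _ _) (hM _ _)) (hM _ _)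

/-- If the coordinate ring of `SL₂` has local coordinates `x, y, t s` everywhere such that the
functions `t s` differ by homogeneous rational functions of degree `-d` in `x, y`, then `d = 2`.
The Euler vector field has divergence `2 - d`, and the Haar integral of a divergence is zero. -/
theorem IsGenericSL2.degree_eq_two {z : Fin 4 → K} (hz : IsGenericSL2 z) {S : Type*} [Nonempty S]
    {L : S → Subalgebra ℂ K} (hL : ∀ r, (∀ s, r ∈ L s) → r ∈ polyRange z)
    (hzL : ∀ s, IsLocalizationIn (polyRange z) (L s)) {x y : K} {t : S → K}
    (hxyt : ∀ s, AlgebraicIndependent ℂ ![x, y, t s])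
    (htL : ∀ s, IsLocalizationIn (polyRange ![x, y, t s]) (L s)) {d : ℤ}
    (htr : ∀ s s', DiffHomogeneous x y (-d) (t s) (t s')) : d = 2 := by
  obtain ⟨F⟩ := hz.nonempty_frame
  obtain ⟨s₀⟩ := ‹Nonempty S›
  obtain ⟨E, hE⟩ := exists_derivation_of_algebraicIndependent (hxyt s₀)
    -- The Euler field is defined by one chart `s₀`; `hEt` shows that it has the same form in every
    -- other chart.
    (hz.frac.of_isLocalizationIn (hzL s₀).1 (htL s₀)) ![x, y, ((-d : ℤ) : K) * t s₀]
  have hEx : E x = x := hE 0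
  have hEy : E y = y := hE 1
  have hEt : ∀ s, E (t s) = ((-d : ℤ) : K) * t s := fun s =>
    (htr s s₀).euler (hxyt s₀) hEx hEy (hE 2)
  -- $E$ is regular on each chart, hence globally regular, so its frame coefficients below are
  -- polynomials in the matrix entries and the Haar functional applies to them.
  have hEz : ∀ i, E (z i) ∈ polyRange z := by
    intro i
    refine hL _ fun s => (htL s).derivation_mem (fun j => ?_) ((hzL s).1 (mem_polyRange z i))
    have hm := fun k => (htL s).1 (mem_polyRange ![x, y, t s] k)
    fin_cases j
    · simpa [hEx] using hm 0
    · simpa [hEy] using hm 1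
    · have : ((-d : ℤ) : K) * t s ∈ L s := (L s).mul_mem ((L s).intCast_mem _) (hm 2)
      simpa [hEt] using this
  have hJ : ∀ s, F.jac x y (t s) = F.jac x y (t s₀) := fun s => (htr s s₀).jac_eq (hxyt s₀) F
  have hunit := fun s => F.jac_mem_and_inv_mem hz (hzL s) (hxyt s) (htL s)
  simp only [hJ] at hunit
  have hEJ : E (F.jac x y (t s₀)) = 0 :=
    hz.derivation_unit (hL _ fun s => (hunit s).1) (hL _ fun s => (hunit s).2.2) E
  -- The weights $1,1,-d$ are written as integer casts so that a single fact shows that they are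
  -- constants.
  have hconst : ∀ (k : ℤ) (D : Derivation ℂ K K), D (k : K) = 0 := fun k D => D.map_intCast k
  have hdiv := F.divergence_eq hz (F.expand hz E) (wx := ((1 : ℤ) : K)) (wy := ((1 : ℤ) : K))
    (by simpa using hEx) (by simpa using hEy) (hEt s₀) (hconst _) (hconst _) (hconst _)
    (hunit s₀).2.1 hEJ
  have hzm := mem_polyRange z
  have hcoef : ∀ i j k l, z i * E (z j) - z k * E (z l) ∈ polyRange z := fun i j k l =>
    (polyRange z).sub_mem ((polyRange z).mul_mem (hzm _) (hEz _))
      ((polyRange z).mul_mem (hzm _) (hEz _))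
  obtain ⟨p, hp⟩ := hcoef 3 1 1 3
  obtain ⟨q, hq⟩ := hcoef 0 2 2 0
  obtain ⟨r, hr⟩ := hcoef 3 0 1 2
  simp only [AlgHom.toRingHom_eq_coe, RingHom.coe_coe] at hp hq hr
  rw [← hp, ← hq, ← hr, F.e_aeval, F.f_aeval, F.h_aeval] at hdiv
  have hmem : C ((2 - d : ℤ) : ℂ) - (derE p + derF q + derH r) ∈ Ideal.span {equation 1 1} := by
    rw [← hz.ker, map_sub, map_add, map_add, hdiv, algHom_C, map_intCast]
    push_cast
    ring
  have := eq_zero_of_divergence_mem hmem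
  have h2 : (2 - d : ℤ) = 0 := by exact_mod_cast this
  linarith

end
end ExoticSphere

end

noncomputable section

namespace ExoticSphere

open MvPolynomial

/-! ### Local rings of a domain in its field of fractions -/

section

variable {K : Type*} [Field K] [Algebra ℂ K] {R : Type*} [CommRing R] [Algebra ℂ R]

/-- The local ring of `R` at the prime ideal `p`, as a subalgebra of the field `K`. -/
def localSubalgebra (ι : R →ₐ[ℂ] K) (p : Ideal R) [hp : p.IsPrime] : Subalgebra ℂ K where
  carrier := {r | ∃ a b : R, b ∉ p ∧ r * ι b = ι a}
  mul_mem' := by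
    rintro r r' ⟨a, b, hb, h⟩ ⟨a', b', hb', h'⟩
    refine ⟨a * a', b * b', fun h => (hp.mem_or_mem h).elim hb hb', ?_⟩
    rw [map_mul, map_mul, ← h, ← h']
    ring
  add_mem' := by
    rintro r r' ⟨a, b, hb, h⟩ ⟨a', b', hb', h'⟩
    refine ⟨a * b' + a' * b, b * b', fun h => (hp.mem_or_mem h).elim hb hb', ?_⟩
    rw [map_mul, map_add, map_mul, map_mul, ← h, ← h']
    ring
  algebraMap_mem' c :=
    ⟨algebraMap ℂ R c, 1, fun h => hp.ne_top ((Ideal.eq_top_iff_one _).mpr h), by simp⟩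

lemma apply_mem_localSubalgebra (ι : R →ₐ[ℂ] K) (p : Ideal R) [hp : p.IsPrime] (a : R) :
    ι a ∈ localSubalgebra ι p :=
  ⟨a, 1, fun h => hp.ne_top ((Ideal.eq_top_iff_one _).mpr h), by simp⟩

lemma inv_mem_localSubalgebra {ι : R →ₐ[ℂ] K} (hι : Function.Injective ι) {p : Ideal R}
    [p.IsPrime] {b : R} (hb : b ∉ p) : (ι b)⁻¹ ∈ localSubalgebra ι p := by
  refine ⟨1, b, hb, ?_⟩
  have : ι b ≠ 0 := by
    rw [Ne, map_eq_zero_iff ι hι]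
    rintro rfl
    exact hb p.zero_mem
  simp [this]

/-- The denominators of `r` form an ideal. Each local ring supplies a denominator outside the
corresponding prime, so the ideal lies in no maximal ideal and contains $1$. -/
lemma mem_range_of_forall_mem_localSubalgebra {ι : R →ₐ[ℂ] K} {r : K}
    (hr : ∀ p : PrimeSpectrum R, r ∈ localSubalgebra ι p.asIdeal) : r ∈ ι.range := by
  let I : Ideal R :=
    { carrier := {b | r * ι b ∈ ι.range}
      add_mem' := by
        intro a b ha hb
        simp only [Set.mem_ofPred_eq, map_add, mul_add] at *
        exact ι.range.add_mem ha hb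
      zero_mem' := ⟨0, by simp⟩
      smul_mem' := by
        intro c b hb
        simp only [Set.mem_ofPred_eq, smul_eq_mul, map_mul] at *
        have : r * (ι c * ι b) = ι c * (r * ι b) := by ring
        rw [this]
        exact ι.range.mul_mem ⟨c, rfl⟩ hb }
  have hI : I = ⊤ := by
    by_contra h
    obtain ⟨m, hm, hIm⟩ := Ideal.exists_le_maximal I h
    obtain ⟨a, b, hb, hab⟩ := hr ⟨m, hm.isPrime⟩
    exact hb (hIm ⟨a, hab.symm⟩)
  have : (1 : R) ∈ I := hI ▸ Submodule.mem_top
  simpa [I] using this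

/-- If the coordinate ring `R` of `SL₂` has local coordinates `x, y, t p` at every prime `p` such
that the functions `t p` differ by homogeneous rational functions of degree `-d` in `x, y`,
then `d = 2`. -/
theorem degree_eq_two_of_local {ι : R →ₐ[ℂ] K} (hι : Function.Injective ι)
    (hfrac : HasFractions ι.range) {z : Fin 4 → R}
    (hz : Function.Surjective (aeval z : MvPolynomial (Fin 4) ℂ →ₐ[ℂ] R))
    (hker : ∀ p : MvPolynomial (Fin 4) ℂ, aeval z p = 0 ↔ p ∈ Ideal.span {equation 1 1})
    {x y : K} {t : PrimeSpectrum R → K} (hxyt : ∀ p, AlgebraicIndependent ℂ ![x, y, t p])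
    (htL : ∀ p, IsLocalizationIn (polyRange ![x, y, t p]) (localSubalgebra ι p.asIdeal)) {d : ℤ}
    (htr : ∀ p p', DiffHomogeneous x y (-d) (t p) (t p')) : d = 2 := by
  have hcomp : ∀ p : MvPolynomial (Fin 4) ℂ, aeval (fun i => ι (z i)) p = ι (aeval z p) :=
    fun p => (MvPolynomial.comp_aeval_apply z ι p).symm
  have hrange : polyRange (fun i => ι (z i)) = ι.range := by
    ext r
    constructor
    · rintro ⟨p, rfl⟩
      exact ⟨aeval z p, (hcomp p).symm⟩
    · rintro ⟨a, rfl⟩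
      obtain ⟨p, rfl⟩ := hz a
      exact ⟨p, hcomp p⟩
  have : Nontrivial R := ι.toRingHom.domain_nontrivial
  have hgen : IsGenericSL2 (fun i => ι (z i)) := by
    have hfrac' : HasFractions (polyRange fun i => ι (z i)) := by rwa [hrange]
    refine ⟨fun p => ?_, hfrac'⟩
    rw [hcomp, map_eq_zero_iff ι hι, hker]
  refine hgen.degree_eq_two (L := fun p : PrimeSpectrum R => localSubalgebra ι p.asIdeal)
    (fun r hr => ?_) (fun p => ?_) hxyt htL htr
  · rw [hrange]
    exact mem_range_of_forall_mem_localSubalgebra hr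
  · rw [hrange]
    refine ⟨?_, ?_⟩
    · rintro _ ⟨a, rfl⟩
      exact apply_mem_localSubalgebra ι _ a
    · rintro r ⟨a, b, hb, h⟩
      refine ⟨ι b, ⟨b, rfl⟩, ?_, inv_mem_localSubalgebra hι hb, ⟨a, h.symm⟩⟩
      rw [Ne, map_eq_zero_iff ι hι]
      rintro rfl
      exact hb p.asIdeal.zero_mem

end
end ExoticSphere

end

noncomputable section

namespace ExoticSphere

open CategoryTheory AlgebraicGeometry

/-! ### Stalks and charts of schemes -/

/-- The sections defined on an open subset `V` by a morphism from `V` to an affine scheme. -/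
def chartMap {X : Scheme.{0}} {V : X.Opens} {P : CommRingCat.{0}} (j : V.toScheme ⟶ Spec P) :
    P ⟶ Γ(X, V) :=
  (Scheme.ΓSpecIso P).inv ≫ j.appTop ≫ V.topIso.hom

lemma exists_germ_mul_eq {X : Scheme.{0}} [IsAffine X] (x : X) (s : X.presheaf.stalk x) :
    ∃ a b : Γ(X, ⊤), IsUnit (X.presheaf.germ ⊤ x (TopologicalSpace.Opens.mem_top _) b) ∧
      s * X.presheaf.germ ⊤ x (TopologicalSpace.Opens.mem_top _) b = X.presheaf.germ ⊤ x (TopologicalSpace.Opens.mem_top _) a := by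
  let := X.presheaf.algebra_section_stalk (U := ⊤) ⟨x, (TopologicalSpace.Opens.mem_top _)⟩
  have := (isAffineOpen_top X).isLocalization_stalk ⟨x, (TopologicalSpace.Opens.mem_top _)⟩
  obtain ⟨⟨a, b⟩, h⟩ := IsLocalization.surj
    ((isAffineOpen_top X).primeIdealOf ⟨x, (TopologicalSpace.Opens.mem_top _)⟩).asIdeal.primeCompl s
  exact ⟨a, b, IsLocalization.map_units (X.presheaf.stalk x) b, h⟩

/-- For an open immersion `j` the stalk map is an isomorphism, so this formula carries fractions and
injectivity over from the affine scheme to the chart. -/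
lemma chartMap_germ {X : Scheme.{0}} {V : X.Opens} {P : CommRingCat.{0}}
    (j : V.toScheme ⟶ Spec P) (x : X) (hx : x ∈ V) :
    chartMap j ≫ X.presheaf.germ V x hx =
      (Scheme.ΓSpecIso P).inv ≫ (Spec P).presheaf.germ ⊤ (j ⟨x, hx⟩) (TopologicalSpace.Opens.mem_top _) ≫
        j.stalkMap ⟨x, hx⟩ ≫ (V.stalkIso ⟨x, hx⟩).hom := by
  have h1 := Scheme.Hom.germ_stalkMap_assoc j ⊤ ⟨x, hx⟩ (TopologicalSpace.Opens.mem_top _) (V.stalkIso ⟨x, hx⟩).hom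
  rw [h1, chartMap, Category.assoc, Category.assoc]
  congr 2
  have h2 := V.germ_stalkIso_hom (V := ⊤) ⟨x, hx⟩ (TopologicalSpace.Opens.mem_top _)
  refine Eq.trans ?_ h2.symm
  rw [Scheme.Opens.topIso_hom]
  exact X.presheaf.germ_res _ _ _

lemma exists_germ_chartMap_mul_eq {X : Scheme.{0}} {V : X.Opens} {P : CommRingCat.{0}}
    (j : V.toScheme ⟶ Spec P) [IsOpenImmersion j] (x : X) (hx : x ∈ V)
    (s : X.presheaf.stalk x) :
    ∃ a b : P, IsUnit (X.presheaf.germ V x hx (chartMap j b)) ∧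
      s * X.presheaf.germ V x hx (chartMap j b) = X.presheaf.germ V x hx (chartMap j a) := by
  have hθ : ∀ a, X.presheaf.germ V x hx (chartMap j a) =
      (j.stalkMap ⟨x, hx⟩ ≫ (V.stalkIso ⟨x, hx⟩).hom)
        ((Spec P).presheaf.germ ⊤ (j ⟨x, hx⟩) (TopologicalSpace.Opens.mem_top _) ((Scheme.ΓSpecIso P).inv a)) := by
    intro a
    exact ConcreteCategory.congr_hom (chartMap_germ j x hx) a
  have hinv : (Scheme.ΓSpecIso P).hom ≫ (Scheme.ΓSpecIso P).inv = 𝟙 _ := Iso.hom_inv_id _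
  have h0 : IsIso (j.stalkMap ⟨x, hx⟩) := ((IsOpenImmersion.iff_isIso_stalkMap (f := j)).mp inferInstance).2 _
  have h0' : IsIso (V.stalkIso ⟨x, hx⟩).hom := inferInstance
  have hiso : IsIso (j.stalkMap ⟨x, hx⟩ ≫ (V.stalkIso ⟨x, hx⟩).hom) := IsIso.comp_isIso
  obtain ⟨s', rfl⟩ := (ConcreteCategory.bijective_of_isIso
    (j.stalkMap ⟨x, hx⟩ ≫ (V.stalkIso ⟨x, hx⟩).hom)).2 s
  obtain ⟨a, b, hb, hab⟩ := exists_germ_mul_eq (j ⟨x, hx⟩) s'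
  refine ⟨(Scheme.ΓSpecIso P).hom a, (Scheme.ΓSpecIso P).hom b, ?_⟩
  have h1 : ∀ a, (Scheme.ΓSpecIso P).inv ((Scheme.ΓSpecIso P).hom a) = a := fun a =>
    ConcreteCategory.congr_hom hinv a
  rw [hθ, hθ, h1, h1, ← hab, map_mul]
  exact ⟨hb.map (j.stalkMap ⟨x, hx⟩ ≫ (V.stalkIso ⟨x, hx⟩).hom).hom, rfl⟩

lemma chartMap_injective {X : Scheme.{0}} [IsIntegral X] {V : X.Opens} {P : CommRingCat.{0}}
    [IsDomain P] (j : V.toScheme ⟶ Spec P) [IsOpenImmersion j] (x : X) (hx : x ∈ V) :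
    Function.Injective (X.presheaf.germ V x hx ∘ chartMap j) := by
  have h0 : IsIso (j.stalkMap ⟨x, hx⟩) := ((IsOpenImmersion.iff_isIso_stalkMap (f := j)).mp inferInstance).2 _
  have h0' : IsIso (V.stalkIso ⟨x, hx⟩).hom := inferInstance
  have hiso : IsIso (j.stalkMap ⟨x, hx⟩ ≫ (V.stalkIso ⟨x, hx⟩).hom) := IsIso.comp_isIso
  have h1 := (ConcreteCategory.bijective_of_isIso
    (j.stalkMap ⟨x, hx⟩ ≫ (V.stalkIso ⟨x, hx⟩).hom)).1
  have h2 := germ_injective_of_isIntegral (Spec P) (U := ⊤) (j ⟨x, hx⟩) (TopologicalSpace.Opens.mem_top _)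
  have h3 := (ConcreteCategory.bijective_of_isIso (Scheme.ΓSpecIso P).inv).1
  have h4 : (X.presheaf.germ V x hx ∘ chartMap j : P → X.presheaf.stalk x) =
      (j.stalkMap ⟨x, hx⟩ ≫ (V.stalkIso ⟨x, hx⟩).hom) ∘
      ((Spec P).presheaf.germ ⊤ (j ⟨x, hx⟩) (TopologicalSpace.Opens.mem_top _) ∘ (Scheme.ΓSpecIso P).inv) := by
    ext a
    exact ConcreteCategory.congr_hom (chartMap_germ j x hx) a
  rw [h4]
  exact h1.comp (h2.comp h3)

lemma isUnit_germ_fromSpec_iff {X : Scheme.{0}} [IsAffine X] (p : PrimeSpectrum Γ(X, ⊤))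
    (b : Γ(X, ⊤)) :
    IsUnit (X.presheaf.germ ⊤ ((isAffineOpen_top X).fromSpec p) (TopologicalSpace.Opens.mem_top _) b) ↔ b ∉ p.asIdeal := by
  refine (X.mem_basicOpen b _ (TopologicalSpace.Opens.mem_top _)).symm.trans ?_
  have h := (isAffineOpen_top X).fromSpec_preimage_basicOpen b
  have h2 : p ∈ (isAffineOpen_top X).fromSpec ⁻¹ᵁ X.basicOpen b ↔ p ∈ PrimeSpectrum.basicOpen b := by
    rw [h]; rfl
  exact h2

section

variable {X : Scheme.{0}} [IsAffine X] [IsIntegral X] [Algebra ℂ Γ(X, ⊤)] [Algebra ℂ X.functionField]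

/-- The local ring at a point of an integral affine scheme is the stalk. -/
lemma mem_localSubalgebra_iff_stalk {ι : Γ(X, ⊤) →ₐ[ℂ] X.functionField}
    (hι : ∀ a, ι a = X.presheaf.germ ⊤ (genericPoint X) (TopologicalSpace.Opens.mem_top _) a) (p : PrimeSpectrum Γ(X, ⊤)) (r : X.functionField) :
    r ∈ localSubalgebra ι p.asIdeal ↔
      ∃ s : X.presheaf.stalk ((isAffineOpen_top X).fromSpec p),
        algebraMap (X.presheaf.stalk ((isAffineOpen_top X).fromSpec p)) X.functionField s = r := by
  set x := (isAffineOpen_top X).fromSpec p with hx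
  have : Nonempty (⊤ : X.Opens) := ⟨⟨x, (TopologicalSpace.Opens.mem_top _)⟩⟩
  have hg : ∀ a, ι a =
      algebraMap (X.presheaf.stalk x) X.functionField (X.presheaf.germ ⊤ x (TopologicalSpace.Opens.mem_top _) a) := by
    intro a
    exact (hι a).trans (X.algebraMap_germ_eq_germToFunctionField _ a).symm
  constructor
  · rintro ⟨a, b, hb, hab⟩
    obtain ⟨c, hc⟩ := ((isUnit_germ_fromSpec_iff p b).mpr hb).exists_left_inv
    refine ⟨X.presheaf.germ ⊤ x (TopologicalSpace.Opens.mem_top _) a * c, ?_⟩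
    rw [map_mul, ← hg, ← hab, hg b, mul_assoc, ← map_mul, mul_comm _ c]
    rw [hc, map_one, mul_one]
  · rintro ⟨s, rfl⟩
    obtain ⟨a, b, hb, hab⟩ := exists_germ_mul_eq x s
    refine ⟨a, b, (isUnit_germ_fromSpec_iff p b).mp hb, ?_⟩
    rw [hg, hg, ← map_mul, hab]

end

end ExoticSphere

end

noncomputable section

namespace ExoticSphere

open CategoryTheory AlgebraicGeometry

/-! ### Charts of the total space of a bundle -/

lemma ι_appTop_topIso_hom {X : Scheme.{0}} (V : X.Opens) :
    V.ι.appTop ≫ V.topIso.hom = X.presheaf.map (homOfLE (le_top : V ≤ ⊤)).op := by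
  rw [Scheme.Opens.ι_appTop, Scheme.Opens.topIso_hom]
  exact (X.presheaf.map_comp _ _).symm

namespace GaBundle

variable (B : GaBundle A2star)

/-- A polynomial in `x, y` as a regular function on the total space. -/
def pullbackPoly : CommRingCat.of Cxy ⟶ Γ(B.X, ⊤) :=
  (Scheme.ΓSpecIso (CommRingCat.of Cxy)).inv ≫ punctured.ι.appTop ≫ B.ρ.appTop

lemma app_polyOn (U : A2star.Opens) (p : Cxy) :
    B.ρ.app U (polyOn U p) =
      B.X.presheaf.map (homOfLE (le_top : B.ρ ⁻¹ᵁ U ≤ ⊤)).op (B.pullbackPoly p) := by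
  have h := B.ρ.naturality (homOfLE (le_top : U ≤ ⊤)).op
  exact ConcreteCategory.congr_hom h
    (punctured.ι.appTop ((Scheme.ΓSpecIso (CommRingCat.of Cxy)).inv p))

variable {B} {U : A2star.Opens} (τ : B.toGaScheme.Trivialization U)

/-- The coordinates `(x, y, t)` on a trivialized part of the total space. -/
def chart : (B.ρ ⁻¹ᵁ U).toScheme ⟶ Spec (CommRingCat.of (MvPolynomial Unit Cxy)) :=
  AffineSpace.homOfVector (B.ρ ∣_ U) (fun _ : Unit => (B.ρ ⁻¹ᵁ U).topIso.inv τ.coord) ≫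
    AffineSpace.map Unit (U.ι ≫ punctured.ι) ≫
      (AffineSpace.SpecIso Unit (CommRingCat.of Cxy)).hom

/-- The trivialization is an isomorphism onto the affine line over `U`, which is open in the affine
line over the plane by base change. -/
instance isOpenImmersion_chart : IsOpenImmersion (chart τ) := by
  have h1 := τ.isIso
  have h2 : IsOpenImmersion (AffineSpace.map Unit (U.ι ≫ punctured.ι)) :=
    MorphismProperty.of_isPullback (P := @IsOpenImmersion)
      (AffineSpace.isPullback_map (n := Unit) (U.ι ≫ punctured.ι)).flip inferInstance
  unfold chart
  infer_instance

lemma chart_specIso_inv : chart τ ≫ (AffineSpace.SpecIso Unit (CommRingCat.of Cxy)).inv =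
    AffineSpace.homOfVector (B.ρ ∣_ U) (fun _ : Unit => (B.ρ ⁻¹ᵁ U).topIso.inv τ.coord) ≫
      AffineSpace.map Unit (U.ι ≫ punctured.ι) := by
  simp only [chart, Category.assoc, Iso.hom_inv_id, Category.comp_id]

lemma chartMap_X : chartMap (chart τ) (MvPolynomial.X ()) = τ.coord := by
  have h1 := AffineSpace.SpecIso_inv_appTop_coord (n := Unit) (CommRingCat.of Cxy) ()
  have h2 := congrArg (fun f => f.appTop (AffineSpace.coord _ ())) (chart_specIso_inv τ)
  simp only [Scheme.Hom.comp_appTop, CommRingCat.comp_apply] at h2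
  rw [h1, AffineSpace.map_appTop_coord, AffineSpace.homOfVector_appTop_coord] at h2
  have h3 := congrArg (B.ρ ⁻¹ᵁ U).topIso.hom h2
  refine Eq.trans h3 ?_
  exact ConcreteCategory.congr_hom (B.ρ ⁻¹ᵁ U).topIso.inv_hom_id τ.coord

lemma chart_specMap : chart τ ≫ Spec.map (CommRingCat.ofHom MvPolynomial.C) =
    (B.ρ ⁻¹ᵁ U).ι ≫ B.ρ ≫ punctured.ι := by
  have h := AffineSpace.SpecIso_inv_over (n := Unit) (CommRingCat.of Cxy)
  refine (congrArg (chart τ ≫ ·) h.symm).trans ?_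
  simp only
  rw [← Category.assoc, chart_specIso_inv, Category.assoc,
    AffineSpace.map_over, AffineSpace.homOfVector_over_assoc, ← Category.assoc,
    morphismRestrict_ι, Category.assoc]

lemma chartMap_C (p : Cxy) : chartMap (chart τ) (MvPolynomial.C p) =
    B.X.presheaf.map (homOfLE (le_top : B.ρ ⁻¹ᵁ U ≤ ⊤)).op (B.pullbackPoly p) := by
  have h1 := congrArg (fun f => f.appTop ((Scheme.ΓSpecIso (CommRingCat.of Cxy)).inv p))
    (chart_specMap τ)
  simp only [Scheme.Hom.comp_appTop, CommRingCat.comp_apply] at h1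
  have h2 := ConcreteCategory.congr_hom (Scheme.ΓSpecIso_inv_naturality
    (CommRingCat.ofHom (MvPolynomial.C : Cxy →+* MvPolynomial Unit Cxy))) p
  erw [← h2] at h1
  have h3 := congrArg (B.ρ ⁻¹ᵁ U).topIso.hom h1
  refine Eq.trans h3 ?_
  exact ConcreteCategory.congr_hom (ι_appTop_topIso_hom (B.ρ ⁻¹ᵁ U)) (B.pullbackPoly p)

end GaBundle
end ExoticSphere

end

noncomputable section

namespace ExoticSphere

open CategoryTheory AlgebraicGeometry

/-! ### The degree of a homogeneous bundle with total space `SL₂` -/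

/-- Polynomials in three variables as polynomials in the last one. -/
def curryPoly : MvPolynomial (Fin 3) ℂ →ₐ[ℂ] MvPolynomial Unit Cxy :=
  MvPolynomial.aeval ![MvPolynomial.C (MvPolynomial.X 0), MvPolynomial.C (MvPolynomial.X 1),
    MvPolynomial.X ()]

/-- Polynomials in one variable over `ℂ[x, y]` as polynomials in three variables. -/
def uncurryPoly : MvPolynomial Unit Cxy →+* MvPolynomial (Fin 3) ℂ :=
  MvPolynomial.eval₂Hom
    (MvPolynomial.aeval ![MvPolynomial.X 0, MvPolynomial.X 1] : Cxy →ₐ[ℂ] _).toRingHom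
    (fun _ => MvPolynomial.X 2)

lemma uncurryPoly_curryPoly (p : MvPolynomial (Fin 3) ℂ) : uncurryPoly (curryPoly p) = p := by
  have : uncurryPoly.comp curryPoly.toRingHom = RingHom.id _ := by
    ext i
    · simp [uncurryPoly, curryPoly]
    · fin_cases i <;> simp [uncurryPoly, curryPoly]
  exact RingHom.congr_fun this p

lemma curryPoly_uncurryPoly (p : MvPolynomial Unit Cxy) : curryPoly (uncurryPoly p) = p := by
  have : curryPoly.toRingHom.comp uncurryPoly = RingHom.id _ := by
    ext i
    · simp [uncurryPoly, curryPoly]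
    · fin_cases i <;> simp [uncurryPoly, curryPoly]
    · simp [uncurryPoly, curryPoly]
  exact RingHom.congr_fun this p

namespace GaBundle

/-- The charts are turned into the data of `degree_eq_two_of_local`: at each prime a chart
containing it is chosen, and its fibre coordinate is viewed in the function field. -/
theorem degree_eq_two_of_coordinates (B : GaBundle A2star) [IsAffine B.X] [IsIntegral B.X]
    [Algebra ℂ Γ(B.X, ⊤)] [Algebra ℂ B.X.functionField]
    (hΓ : ∀ c : ℂ, algebraMap ℂ Γ(B.X, ⊤) c = B.pullbackPoly (MvPolynomial.C c))
    {ι : Γ(B.X, ⊤) →ₐ[ℂ] B.X.functionField}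
    (hι : ∀ a, ι a =
      B.X.presheaf.germ ⊤ (genericPoint B.X) (TopologicalSpace.Opens.mem_top _) a)
    {z : Fin 4 → Γ(B.X, ⊤)}
    (hz : Function.Surjective (MvPolynomial.aeval z : MvPolynomial (Fin 4) ℂ →ₐ[ℂ] Γ(B.X, ⊤)))
    (hker : ∀ p : MvPolynomial (Fin 4) ℂ,
      MvPolynomial.aeval z p = 0 ↔ p ∈ Ideal.span {equation 1 1})
    {d : ℤ} (hB : B.IsHomogeneous (-d)) : d = 2 := by
  have hιinj : Function.Injective ι := by
    have h := germ_injective_of_isIntegral B.X (U := ⊤) (genericPoint B.X)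
      (TopologicalSpace.Opens.mem_top _)
    intro a b hab
    rw [hι, hι] at hab
    exact h hab
  have hfrac : HasFractions ι.range := by
    intro r
    obtain ⟨a, b, hb, hab⟩ := exists_germ_mul_eq (genericPoint B.X) r
    refine ⟨ι b, ⟨b, rfl⟩, ?_, ⟨a, ?_⟩⟩
    · rw [hι]
      exact hb.ne_zero
    · exact (hι a).trans (hab.symm.trans (congrArg (r * ·) (hι b).symm))
  obtain ⟨I, U, τ, hU, -, htr⟩ := hB
  have hcov : ∀ P : PrimeSpectrum Γ(B.X, ⊤), ∃ i,
      (isAffineOpen_top B.X).fromSpec P ∈ B.ρ ⁻¹ᵁ (U i) := by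
    intro P
    have : B.ρ ((isAffineOpen_top B.X).fromSpec P) ∈ ⨆ i, U i := hU ▸ TopologicalSpace.Opens.mem_top _
    obtain ⟨i, hi⟩ := TopologicalSpace.Opens.mem_iSup.mp this
    exact ⟨i, hi⟩
  choose i hi using hcov
  -- The generic point lies in every nonempty open subset, so functions from all charts can be
  -- compared in one field.
  have hgen : ∀ P, genericPoint B.X ∈ B.ρ ⁻¹ᵁ (U (i P)) := fun P =>
    ((genericPoint_spec B.X).mem_open_set_iff (B.ρ ⁻¹ᵁ (U (i P))).isOpen).mpr ⟨_, trivial, hi P⟩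
  let t : PrimeSpectrum Γ(B.X, ⊤) → B.X.functionField := fun P =>
    B.X.presheaf.germ (B.ρ ⁻¹ᵁ (U (i P))) (genericPoint B.X) (hgen P) (τ (i P)).coord
  let xy : Cxy →ₐ[ℂ] B.X.functionField :=
    { toRingHom := ι.toRingHom.comp B.pullbackPoly.hom
      commutes' := by
        intro c
        have h1 : B.pullbackPoly.hom (algebraMap ℂ Cxy c) = algebraMap ℂ Γ(B.X, ⊤) c := (hΓ c).symm
        simp only [RingHom.comp_apply, RingHom.toMonoidHom_eq_coe, OneHom.toFun_eq_coe,
          MonoidHom.toOneHom_coe, MonoidHom.coe_coe, h1]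
        exact ι.commutes c }
  have hxy : ∀ q, MvPolynomial.aeval ![xy (MvPolynomial.X 0), xy (MvPolynomial.X 1)] q = xy q := by
    intro q
    have : MvPolynomial.aeval ![xy (MvPolynomial.X 0), xy (MvPolynomial.X 1)] = xy := by
      ext j
      fin_cases j <;> simp
    rw [this]
  -- Evaluation at `(x, y, t P)` is pullback along the chart followed by the germ at the generic
  -- point. Injectivity of the pullback will give algebraic independence, and the stalk isomorphism
  -- will give the localization property.
  have hθ : ∀ P f, MvPolynomial.aeval ![xy (MvPolynomial.X 0), xy (MvPolynomial.X 1), t P] f =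
      B.X.presheaf.germ _ (genericPoint B.X) (hgen P) (chartMap (chart (τ (i P))) (curryPoly f)) := by
    intro P f
    let θ : MvPolynomial (Fin 3) ℂ →+* B.X.functionField :=
      ((chartMap (chart (τ (i P))) ≫
        B.X.presheaf.germ _ (genericPoint B.X) (hgen P)).hom).comp curryPoly.toRingHom
    have hC : ∀ q, B.X.presheaf.germ _ (genericPoint B.X) (hgen P)
        (chartMap (chart (τ (i P))) (MvPolynomial.C q)) = xy q := by
      intro q
      rw [chartMap_C]
      refine (TopCat.Presheaf.germ_res_apply B.X.presheaf _ _ (hgen P) (B.pullbackPoly q)).trans ?_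
      exact (hι _).symm
    have : (MvPolynomial.aeval ![xy (MvPolynomial.X 0), xy (MvPolynomial.X 1), t P] :
        MvPolynomial (Fin 3) ℂ →ₐ[ℂ] B.X.functionField).toRingHom = θ := by
      refine MvPolynomial.ringHom_ext (fun c => ?_) (fun j => ?_)
      · have h1 : curryPoly (MvPolynomial.C c) = MvPolynomial.C (MvPolynomial.C c) :=
          curryPoly.commutes c
        have h2 : xy (MvPolynomial.C c) = algebraMap ℂ _ c := xy.commutes c
        refine Eq.trans ?_ ((hC (MvPolynomial.C c)).symm.trans ?_)
        · rw [h2]; exact AlgHom.commutes _ c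
        · exact congrArg (fun f => B.X.presheaf.germ _ (genericPoint B.X) (hgen P)
            (chartMap (chart (τ (i P))) f)) h1.symm
      · have h3 : curryPoly (MvPolynomial.X j) = ![MvPolynomial.C (MvPolynomial.X 0),
          MvPolynomial.C (MvPolynomial.X 1), MvPolynomial.X ()] j := MvPolynomial.aeval_X _ _
        have h4 : θ (MvPolynomial.X j) = B.X.presheaf.germ _ (genericPoint B.X) (hgen P)
            (chartMap (chart (τ (i P))) (curryPoly (MvPolynomial.X j))) := rfl
        refine Eq.trans (MvPolynomial.aeval_X _ _) (Eq.trans ?_ h4.symm)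
        rw [h3]
        fin_cases j
        · exact (hC _).symm
        · exact (hC _).symm
        · exact congrArg (B.X.presheaf.germ _ (genericPoint B.X) (hgen P))
            (chartMap_X (τ (i P))).symm
    exact RingHom.congr_fun this f
  have hstalk : ∀ P f, algebraMap (B.X.presheaf.stalk ((isAffineOpen_top B.X).fromSpec P))
      B.X.functionField (B.X.presheaf.germ _ _ (hi P) (chartMap (chart (τ (i P))) f)) =
      B.X.presheaf.germ _ (genericPoint B.X) (hgen P) (chartMap (chart (τ (i P))) f) := by
    intro P f
    have : Nonempty (B.ρ ⁻¹ᵁ (U (i P))) := ⟨⟨_, hi P⟩⟩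
    exact B.X.algebraMap_germ_eq_germToFunctionField (hi P) _
  refine degree_eq_two_of_local hιinj hfrac hz hker (x := xy (MvPolynomial.X 0))
    (y := xy (MvPolynomial.X 1)) (t := t) ?_ ?_ ?_
  · intro P f g hfg
    have h1 : curryPoly f = curryPoly g := by
      refine chartMap_injective (chart (τ (i P))) (genericPoint B.X) (hgen P) ?_
      exact (hθ P f).symm.trans (hfg.trans (hθ P g))
    rw [← uncurryPoly_curryPoly f, h1, uncurryPoly_curryPoly]
  · intro P
    refine ⟨?_, ?_⟩
    · rintro _ ⟨f, rfl⟩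
      rw [mem_localSubalgebra_iff_stalk hι]
      exact ⟨_, (hstalk P _).trans (hθ P f).symm⟩
    · intro r hr
      obtain ⟨s, rfl⟩ := (mem_localSubalgebra_iff_stalk hι P r).mp hr
      obtain ⟨a, b, hb, hab⟩ := exists_germ_chartMap_mul_eq (chart (τ (i P))) _ (hi P) s
      obtain ⟨c, hc⟩ := hb.exists_left_inv
      have hθ' : ∀ f, MvPolynomial.aeval ![xy (MvPolynomial.X 0), xy (MvPolynomial.X 1), t P]
          (uncurryPoly f) = algebraMap (B.X.presheaf.stalk ((isAffineOpen_top B.X).fromSpec P))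
            B.X.functionField (B.X.presheaf.germ _ _ (hi P) (chartMap (chart (τ (i P))) f)) := by
        intro f
        refine (hθ P _).trans ?_
        rw [curryPoly_uncurryPoly]
        exact (hstalk P f).symm
      have hc' := congrArg (algebraMap (B.X.presheaf.stalk ((isAffineOpen_top B.X).fromSpec P))
            B.X.functionField) hc
      rw [map_mul, map_one, ← hθ' b] at hc'
      refine ⟨_, ⟨uncurryPoly b, rfl⟩, right_ne_zero_of_mul_eq_one hc', ?_, uncurryPoly a, ?_⟩
      · rw [mem_localSubalgebra_iff_stalk hι]
        exact ⟨c, eq_inv_of_mul_eq_one_left hc'⟩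
      · refine (hθ' a).trans ?_
        rw [← hab, map_mul, ← hθ' b]
        rfl
  · intro P Q
    obtain ⟨h, ⟨a, b, p, q, hp, hq, hq0, hab, hpq⟩, htrans⟩ := htr (i P) (i Q)
    refine ⟨a, b, p, q, hp, hq, hq0, hab, ?_⟩
    rw [hxy, hxy]
    have hmem : genericPoint B.X ∈ B.ρ ⁻¹ᵁ (U (i P) ⊓ U (i Q)) := ⟨hgen P, hgen Q⟩
    have hpoly : ∀ f, B.X.presheaf.germ _ (genericPoint B.X) hmem
        (B.ρ.app (U (i P) ⊓ U (i Q)) (polyOn _ f)) = xy f := by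
      intro f
      rw [app_polyOn]
      refine (TopCat.Presheaf.germ_res_apply B.X.presheaf _ _ hmem (B.pullbackPoly f)).trans ?_
      exact (hι _).symm
    have hdiff : B.X.presheaf.germ _ (genericPoint B.X) hmem
        (B.ρ.app (U (i P) ⊓ U (i Q)) h) = t P - t Q := by
      rw [htrans, map_sub]
      congr 1
      · exact TopCat.Presheaf.germ_res_apply B.X.presheaf _ _ hmem (τ (i P)).coord
      · exact TopCat.Presheaf.germ_res_apply B.X.presheaf _ _ hmem (τ (i Q)).coord
    rw [← hpoly q, ← hpoly p, ← hdiff, ← map_mul, ← map_mul, hpq]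

end GaBundle
end ExoticSphere

end

noncomputable section

namespace ExoticSphere

open CategoryTheory AlgebraicGeometry

/-! ### Coordinate rings of hypersurfaces -/

/-- The coordinate ring of the hypersurface `{f = 0}`. -/
abbrev CoordRing {σ : Type} (f : MvPolynomial σ ℂ) : Type := MvPolynomial σ ℂ ⧸ Ideal.span {f}

/-- Isomorphic coordinate rings give isomorphic hypersurfaces. -/
def hypersurfaceIso {σ τ : Type} {f : MvPolynomial σ ℂ} {g : MvPolynomial τ ℂ}
    (e : CoordRing g ≃ₐ[ℂ] CoordRing f) : hypersurface f ≅ hypersurface g :=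
  Over.isoMk (Scheme.Spec.mapIso e.toRingEquiv.toCommRingCatIso.op) (by
    dsimp [hypersurface]
    rw [← Spec.map_comp]
    congr 1
    ext c
    exact e.commutes c)

/-- Isomorphic hypersurfaces have isomorphic coordinate rings. -/
def coordRingEquiv {σ τ : Type} {f : MvPolynomial σ ℂ} {g : MvPolynomial τ ℂ}
    (i : hypersurface f ≅ hypersurface g) : CoordRing g ≃ₐ[ℂ] CoordRing f := by
  let i' : Spec (CommRingCat.of (CoordRing f)) ≅ Spec (CommRingCat.of (CoordRing g)) :=
    (Over.forget _).mapIso i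
  refine AlgEquiv.ofRingEquiv (f := (Scheme.Spec.preimageIso i').unop.commRingCatIsoToRingEquiv) ?_
  intro c
  have h1 : i'.hom ≫ Spec.map (CommRingCat.ofHom (algebraMap ℂ (CoordRing g))) =
    Spec.map (CommRingCat.ofHom (algebraMap ℂ (CoordRing f))) := Over.w i.hom
  have h2 : Spec.map (Scheme.Spec.preimageIso i').unop.hom = i'.hom :=
    Scheme.Spec.map_preimage i'.hom
  rw [← h2, ← Spec.map_comp] at h1
  exact ConcreteCategory.congr_hom (Spec.map_injective h1) c

/-! ### Integrality and smoothness of $X_{m,n}$ -/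

lemma isRelPrime_of_eval (m n : ℕ) :
    IsRelPrime (MvPolynomial.X 0 ^ m : MvPolynomial (Fin 4) ℂ)
      (-(MvPolynomial.X 1 ^ n * MvPolynomial.X 2) - 1) := by
  intro d hd1 hd2
  obtain ⟨k, hk, hdk⟩ := (dvd_prime_pow (MvPolynomial.X_prime (R := ℂ) (i := (0 : Fin 4))) m).mp hd1
  rcases k with _ | k
  · exact associated_one_iff_isUnit.mp (by simpa using hdk)
  · have h : (MvPolynomial.X 0 : MvPolynomial (Fin 4) ℂ) ∣
        -(MvPolynomial.X 1 ^ n * MvPolynomial.X 2) - 1 :=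
      (dvd_pow_self _ (Nat.succ_ne_zero k)).trans (hdk.symm.dvd.trans hd2)
    obtain ⟨r, hr⟩ := h
    have := congrArg (MvPolynomial.eval (0 : Fin 4 → ℂ)) hr
    simp at this

/-- The equation is linear in $v$ with coprime coefficients $x^m$ and $-y^nu-1$: the latter has
value $-1$ at the origin, so $x$ does not divide it. It is therefore irreducible. -/
lemma prime_equation (m n : ℕ) : Prime (equation m n) := by
  have h : Irreducible (MvPolynomial.X 0 ^ m * MvPolynomial.X 3 +
      (-(MvPolynomial.X 1 ^ n * MvPolynomial.X 2) - 1) : MvPolynomial (Fin 4) ℂ) := by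
    refine MvPolynomial.irreducible_mul_X_add _ _ 3 (pow_ne_zero _ (MvPolynomial.X_ne_zero 0))
      ?_ ?_ (isRelPrime_of_eval m n)
    · intro h
      simpa using MvPolynomial.vars_pow _ _ h
    · intro h
      rcases Finset.mem_union.mp (MvPolynomial.vars_sub_subset _ h) with h | h
      · rw [MvPolynomial.vars_neg] at h
        rcases Finset.mem_union.mp (MvPolynomial.vars_mul _ _ h) with h | h
        · simpa using MvPolynomial.vars_pow _ _ h
        · simp at h
      · simp at h
  have h2 : equation m n = MvPolynomial.X 0 ^ m * MvPolynomial.X 3 +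
      (-(MvPolynomial.X 1 ^ n * MvPolynomial.X 2) - 1) := by
    rw [equation]; ring
  rw [h2]
  exact h.prime

instance isDomain_coordRing_equation (m n : ℕ) : IsDomain (CoordRing (equation m n)) := by
  have : (Ideal.span {equation m n}).IsPrime :=
    (Ideal.span_singleton_prime (prime_equation m n).ne_zero).mpr (prime_equation m n)
  exact Ideal.Quotient.isDomain _

/-- Infinitesimal lifting is explicit. Lift the coordinates through a square-zero ideal with error
$\varepsilon$ in the equation. As $x^mv-y^nu$ is linear in $(u,v)$, scaling $u,v$ by $1-\varepsilon$
changes its value $1+\varepsilon$ to $1-\varepsilon^2 = 1$. -/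
instance smooth_coordRing_equation (m n : ℕ) : Algebra.Smooth ℂ (CoordRing (equation m n)) where
  formallySmooth := by
    refine Algebra.FormallySmooth.of_comp_surjective fun B _ _ I hI φ => ?_
    let mk : MvPolynomial (Fin 4) ℂ →ₐ[ℂ] CoordRing (equation m n) :=
      Ideal.Quotient.mkₐ ℂ (Ideal.span {equation m n})
    choose w hw using fun j =>
      Ideal.Quotient.mk_surjective (I := I) (φ (mk (MvPolynomial.X j)))
    set ε : B := w 0 ^ m * w 3 - w 1 ^ n * w 2 - 1 with hε
    have hεI : ε ∈ I := by
      rw [← Ideal.Quotient.eq_zero_iff_mem, hε]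
      have h0 : mk (equation m n) = 0 :=
        Ideal.Quotient.eq_zero_iff_mem.mpr (Ideal.mem_span_singleton_self _)
      have h1 : (φ.comp mk) (equation m n) = 0 := by rw [AlgHom.comp_apply, h0, map_zero]
      simp only [equation, map_sub, map_mul, map_pow, map_one] at h1
      simp only [map_sub, map_mul, map_pow, map_one, hw]
      exact h1
    have hε2 : ε * ε = 0 := by
      have : ε * ε ∈ I ^ 2 := by
        rw [pow_two]
        exact Ideal.mul_mem_mul hεI hεI
      rwa [hI, Ideal.mem_bot] at this
    let ψ : CoordRing (equation m n) →ₐ[ℂ] B := Ideal.Quotient.liftₐ (Ideal.span {equation m n})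
      (MvPolynomial.aeval ![w 0, w 1, (1 - ε) * w 2, (1 - ε) * w 3]) (by
        intro a ha
        obtain ⟨r, rfl⟩ := Ideal.mem_span_singleton'.mp ha
        rw [map_mul]
        convert mul_zero _
        simp only [equation, map_sub, map_mul, map_pow, MvPolynomial.aeval_X, map_one,
          Matrix.cons_val]
        linear_combination (ε - 1) * hε - hε2)
    refine ⟨ψ, ?_⟩
    have hsurj : Function.Surjective mk := Ideal.Quotient.mk_surjective
    rw [← AlgHom.cancel_right hsurj]
    ext j
    have h1 : ψ (mk (MvPolynomial.X j)) = ![w 0, w 1, (1 - ε) * w 2, (1 - ε) * w 3] j := by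
      exact MvPolynomial.aeval_X (R := ℂ) _ j
    have h2 : Ideal.Quotient.mk I ε = 0 := Ideal.Quotient.eq_zero_iff_mem.mpr hεI
    simp only [AlgHom.comp_apply, h1, ← hw]
    fin_cases j <;> simp [h2]
  finitePresentation :=
    Algebra.FinitePresentation.quotient ⟨{equation m n}, by simp⟩

instance isIntegral_Xmn (m n : ℕ) : IsIntegral (Xmn m n).left :=
  inferInstanceAs (IsIntegral (Spec (CommRingCat.of (CoordRing (equation m n)))))

lemma isIso_appTop {X Y : Scheme.{0}} (i : X ≅ Y) : IsIso i.hom.appTop :=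
  inferInstanceAs (IsIso (i.hom.app ⊤))

theorem GaBundle.degree_eq_two {B : GaBundle A2star} {d : ℤ} (hB : B.IsHomogeneous (-d))
    (i : B.totalSpace ≅ Xmn 1 1) : d = 2 := by
  let i' : B.X ≅ Spec (CommRingCat.of (CoordRing (equation 1 1))) := (Over.forget _).mapIso i
  have : IsAffine B.X := .of_isIso i'.hom
  have : Nonempty B.X := i'.inv.homeomorph.symm.nonempty
  have : IsIntegral B.X := isIntegral_of_isOpenImmersion i'.hom
  have hw : i'.hom ≫ Spec.map (CommRingCat.ofHom (algebraMap ℂ (CoordRing (equation 1 1)))) =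
    B.ρ ≫ A2star.toSpecC := Over.w i.hom
  -- Constants act through the structure morphism of the total space, which makes the isomorphism
  -- over $\mathbb{C}$ linear on sections.
  let a1 : Algebra ℂ Γ(B.X, ⊤) := (B.pullbackPoly.hom.comp MvPolynomial.C).toAlgebra
  let a2 : Algebra ℂ B.X.functionField :=
    ((B.X.presheaf.germ ⊤ (genericPoint B.X) (TopologicalSpace.Opens.mem_top _)).hom.comp
      (algebraMap ℂ Γ(B.X, ⊤))).toAlgebra
  let ι : Γ(B.X, ⊤) →ₐ[ℂ] B.X.functionField :=
    { toRingHom := (B.X.presheaf.germ ⊤ (genericPoint B.X) (TopologicalSpace.Opens.mem_top _)).hom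
      commutes' := fun c => rfl }
  let β : CoordRing (equation 1 1) →ₐ[ℂ] Γ(B.X, ⊤) :=
    { toRingHom := ((Scheme.ΓSpecIso (CommRingCat.of (CoordRing (equation 1 1)))).inv ≫
        i'.hom.appTop).hom
      commutes' := fun c => by
        have h1 := congrArg (fun f => f.appTop ((Scheme.ΓSpecIso (CommRingCat.of ℂ)).inv c)) hw
        simp only [A2star.toSpecC, Scheme.Hom.comp_appTop, CommRingCat.comp_apply] at h1
        have h2 := ConcreteCategory.congr_hom (Scheme.ΓSpecIso_inv_naturality
          (CommRingCat.ofHom (algebraMap ℂ (CoordRing (equation 1 1))))) c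
        have h3 := ConcreteCategory.congr_hom (Scheme.ΓSpecIso_inv_naturality
          (CommRingCat.ofHom (MvPolynomial.C : ℂ →+* Cxy))) c
        refine (congrArg i'.hom.appTop h2).trans (h1.trans ?_)
        exact (congrArg (fun a => B.ρ.appTop (punctured.ι.appTop a)) h3).symm }
  have h0 : IsIso i'.hom.appTop := isIso_appTop i'
  have h0' : IsIso ((Scheme.ΓSpecIso (CommRingCat.of (CoordRing (equation 1 1)))).inv ≫
    i'.hom.appTop) := IsIso.comp_isIso
  have hβ : Function.Bijective β := ConcreteCategory.bijective_of_isIso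
    ((Scheme.ΓSpecIso (CommRingCat.of (CoordRing (equation 1 1)))).inv ≫ i'.hom.appTop)
  have hβz : ∀ p, MvPolynomial.aeval (fun j => β (Ideal.Quotient.mk _ (MvPolynomial.X j))) p =
      β (Ideal.Quotient.mk _ p) := by
    intro p
    have : MvPolynomial.aeval (fun j => β (Ideal.Quotient.mk _ (MvPolynomial.X j))) =
        β.comp (Ideal.Quotient.mkₐ ℂ (Ideal.span {equation 1 1})) := by
      ext j
      simp
    rw [this]
    rfl
  refine B.degree_eq_two_of_coordinates (ι := ι)
    (z := fun j => β (Ideal.Quotient.mk _ (MvPolynomial.X j))) (fun c => rfl) (fun a => rfl)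
    ?_ ?_ hB
  · intro a
    obtain ⟨b, rfl⟩ := hβ.2 a
    obtain ⟨p, rfl⟩ := Ideal.Quotient.mk_surjective b
    exact ⟨p, hβz p⟩
  · intro p
    rw [hβz, map_eq_zero_iff β hβ.1, Ideal.Quotient.eq_zero_iff_mem]

end ExoticSphere

end

noncomputable section

namespace ExoticSphere

open CategoryTheory AlgebraicGeometry

/-! ### The isomorphisms `X₁₁ ≃ SL₂ ≃ 𝕊³` -/

/-- A homomorphism from the coordinate ring of a hypersurface, given by a zero of the equation. -/
def coordLift {σ : Type} {f : MvPolynomial σ ℂ} {R : Type*} [CommRing R] [Algebra ℂ R] (v : σ → R)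
    (hv : MvPolynomial.aeval v f = 0) : CoordRing f →ₐ[ℂ] R :=
  Ideal.Quotient.liftₐ (Ideal.span {f}) (MvPolynomial.aeval v) (by
    intro a ha
    obtain ⟨r, rfl⟩ := Ideal.mem_span_singleton'.mp ha
    rw [map_mul, hv, mul_zero])

/-- The class of a polynomial in the coordinate ring. -/
def coordMk {σ : Type} (f : MvPolynomial σ ℂ) : MvPolynomial σ ℂ →ₐ[ℂ] CoordRing f :=
  Ideal.Quotient.mkₐ ℂ (Ideal.span {f})

lemma coordMk_surjective {σ : Type} (f : MvPolynomial σ ℂ) : Function.Surjective (coordMk f) :=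
  Ideal.Quotient.mk_surjective

lemma coordMk_eq_zero_iff {σ : Type} {f p : MvPolynomial σ ℂ} :
    coordMk f p = 0 ↔ p ∈ Ideal.span {f} :=
  Ideal.Quotient.eq_zero_iff_mem

lemma coordMk_self {σ : Type} (f : MvPolynomial σ ℂ) : coordMk f f = 0 :=
  coordMk_eq_zero_iff.mpr (Ideal.mem_span_singleton_self _)

lemma coordLift_coordMk {σ : Type} {f : MvPolynomial σ ℂ} {R : Type*} [CommRing R] [Algebra ℂ R]
    (v : σ → R) (hv : MvPolynomial.aeval v f = 0) (p : MvPolynomial σ ℂ) :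
    coordLift v hv (coordMk f p) = MvPolynomial.aeval v p := rfl

lemma coordRing_hom_ext {σ : Type} {f : MvPolynomial σ ℂ} {R : Type*} [CommRing R] [Algebra ℂ R]
    {φ ψ : CoordRing f →ₐ[ℂ] R}
    (h : ∀ i, φ (coordMk f (MvPolynomial.X i)) = ψ (coordMk f (MvPolynomial.X i))) : φ = ψ := by
  rw [← AlgHom.cancel_right (coordMk_surjective f)]
  ext i
  exact h i

lemma aeval_coordMk {σ : Type} (f p : MvPolynomial σ ℂ) :
    MvPolynomial.aeval (fun i => coordMk f (MvPolynomial.X i)) p = coordMk f p := by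
  rw [← MvPolynomial.comp_aeval_apply]
  simp

/-- Mutually inverse polynomial maps give an isomorphism of coordinate rings. -/
def coordEquiv {σ τ : Type} {f : MvPolynomial σ ℂ} {g : MvPolynomial τ ℂ}
    (v : σ → MvPolynomial τ ℂ) (w : τ → MvPolynomial σ ℂ)
    (hv : MvPolynomial.aeval v f = g) (hw : MvPolynomial.aeval w g = f)
    (hvw : ∀ i, MvPolynomial.aeval w (v i) = MvPolynomial.X i)
    (hwv : ∀ i, MvPolynomial.aeval v (w i) = MvPolynomial.X i) : CoordRing f ≃ₐ[ℂ] CoordRing g :=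
  AlgEquiv.ofAlgHom
    (coordLift (fun i => coordMk g (v i))
      (by rw [← MvPolynomial.comp_aeval_apply, hv, coordMk_self]))
    (coordLift (fun i => coordMk f (w i))
      (by rw [← MvPolynomial.comp_aeval_apply, hw, coordMk_self]))
    (coordRing_hom_ext fun i => by
      simp only [AlgHom.comp_apply, coordLift_coordMk, MvPolynomial.aeval_X, AlgHom.id_apply]
      rw [← MvPolynomial.comp_aeval_apply, hwv])
    (coordRing_hom_ext fun i => by
      simp only [AlgHom.comp_apply, coordLift_coordMk, MvPolynomial.aeval_X, AlgHom.id_apply]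
      rw [← MvPolynomial.comp_aeval_apply, hvw])

/-- `X₁₁` is isomorphic to `SL₂`. -/
def isoXmnSL2 : Xmn 1 1 ≅ SL2 :=
  hypersurfaceIso (f := equation 1 1) (coordEquiv
    (fun i : Fin 2 × Fin 2 => (!![MvPolynomial.X 0, MvPolynomial.X 1;
      MvPolynomial.X 2, MvPolynomial.X 3] : Matrix (Fin 2) (Fin 2) _) i.1 i.2)
    ![MvPolynomial.X (0, 0), MvPolynomial.X (0, 1), MvPolynomial.X (1, 0), MvPolynomial.X (1, 1)]
    (by simp [Matrix.det_fin_two, equation])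
    (by simp [Matrix.det_fin_two, equation])
    (by rintro ⟨i, j⟩; fin_cases i <;> fin_cases j <;> simp)
    (by intro i; fin_cases i <;> simp))

lemma C_I_mul_self {σ : Type} :
    (MvPolynomial.C Complex.I * MvPolynomial.C Complex.I : MvPolynomial σ ℂ) = -1 := by
  rw [← map_mul, Complex.I_mul_I, map_neg, map_one]

lemma C_half_mul_two {σ : Type} : (MvPolynomial.C (1 / 2) * 2 : MvPolynomial σ ℂ) = 1 := by
  have : (2 : MvPolynomial σ ℂ) = MvPolynomial.C 2 := (map_ofNat _ 2).symm
  rw [this, ← map_mul]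
  simp

lemma sum_sq_fin_four : (∑ i : Fin (3 + 1), MvPolynomial.X i ^ 2 : MvPolynomial (Fin (3 + 1)) ℂ) =
    MvPolynomial.X 0 ^ 2 + MvPolynomial.X 1 ^ 2 + MvPolynomial.X 2 ^ 2 + MvPolynomial.X 3 ^ 2 :=
  Fin.sum_univ_four _

open MvPolynomial in
/-- `SL₂` is isomorphic to the affine sphere of dimension `3`. -/
def isoSL2Sphere : SL2 ≅ sphere 3 :=
  hypersurfaceIso (coordEquiv
    -- The substitution is $x,v = z_1 \pm iz_2$, $y = -(z_3+iz_4)$, $u = z_3-iz_4$, for which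
    -- $xv-yu$ is the sum of squares. This vector is its inverse.
    ![C (1 / 2) * (X (0, 0) + X (1, 1)), C (1 / 2) * C Complex.I * (X (1, 1) - X (0, 0)),
      C (1 / 2) * (X (1, 0) - X (0, 1)), C (1 / 2) * C Complex.I * (X (0, 1) + X (1, 0))]
    (fun i : Fin 2 × Fin 2 => (!![X 0 + C Complex.I * X 1, -(X 2 + C Complex.I * X 3);
      X 2 - C Complex.I * X 3, X 0 - C Complex.I * X 1] : Matrix (Fin 2) (Fin 2) _) i.1 i.2)
    (by
      have h1 := C_I_mul_self (σ := Fin 2 × Fin 2)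
      have h2 := C_half_mul_two (σ := Fin 2 × Fin 2)
      rw [sum_sq_fin_four]
      -- `one_div` is excluded to keep `C (1 / 2)` in the form in which `h2` uses it.
      simp [-one_div, Matrix.det_fin_two]
      linear_combination C (1 / 2) ^ 2 * ((X (1, 1) - X (0, 0)) ^ 2 + (X (0, 1) + X (1, 0)) ^ 2) * h1
        + (X (0, 0) * X (1, 1) - X (0, 1) * X (1, 0)) * (C (1 / 2) * 2 + 1) * h2)
    (by
      have h1 := C_I_mul_self (σ := Fin 4)
      rw [sum_sq_fin_four]
      simp [Matrix.det_fin_two]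
      linear_combination (-X 1 ^ 2 - X 3 ^ 2) * h1)
    (by
      have h1 := C_I_mul_self (σ := Fin 4)
      have h2 := C_half_mul_two (σ := Fin 4)
      intro i
      fin_cases i
      · simp [-one_div, algHom_C, algebraMap_eq]
        linear_combination X 0 * h2
      · simp [-one_div, algHom_C, algebraMap_eq]
        linear_combination X 1 * h2 - C (1 / 2) * 2 * X 1 * h1
      · simp [-one_div, algHom_C, algebraMap_eq]
        linear_combination X 2 * h2
      · simp [-one_div, algHom_C, algebraMap_eq]
        linear_combination X 3 * h2 - C (1 / 2) * 2 * X 3 * h1)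
    (by
      have h1 := C_I_mul_self (σ := Fin 2 × Fin 2)
      have h2 := C_half_mul_two (σ := Fin 2 × Fin 2)
      rintro ⟨i, j⟩
      fin_cases i <;> fin_cases j
      · simp [-one_div, algHom_C, algebraMap_eq]
        linear_combination C (1 / 2) * (X (1, 1) - X (0, 0)) * h1 + X (0, 0) * h2
      · simp [-one_div, algHom_C, algebraMap_eq]
        linear_combination -C (1 / 2) * (X (0, 1) + X (1, 0)) * h1 + X (0, 1) * h2
      · simp [-one_div, algHom_C, algebraMap_eq]
        linear_combination -C (1 / 2) * (X (0, 1) + X (1, 0)) * h1 + X (1, 0) * h2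
      · simp [-one_div, algHom_C, algebraMap_eq]
        linear_combination -C (1 / 2) * (X (1, 1) - X (0, 0)) * h1 + X (1, 1) * h2))

end ExoticSphere

end

noncomputable section

namespace ExoticSphere

open MvPolynomial

/-! ### Local coordinates on `X_{m,n}` -/

/-- The elements of an algebra that lie in the subalgebra `S` after multiplication by a power
of `a ∈ S`. -/
def awaySubalgebra {A : Type*} [CommRing A] [Algebra ℂ A] (S : Subalgebra ℂ A) {a : A}
    (ha : a ∈ S) : Subalgebra ℂ A where
  carrier := {k | ∃ N : ℕ, k * a ^ N ∈ S}
  mul_mem' := by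
    rintro k k' ⟨N, hN⟩ ⟨N', hN'⟩
    refine ⟨N + N', ?_⟩
    have : k * k' * a ^ (N + N') = (k * a ^ N) * (k' * a ^ N') := by ring
    rw [this]
    exact S.mul_mem hN hN'
  add_mem' := by
    rintro k k' ⟨N, hN⟩ ⟨N', hN'⟩
    refine ⟨N + N', ?_⟩
    have : (k + k') * a ^ (N + N') = (k * a ^ N) * a ^ N' + (k' * a ^ N') * a ^ N := by ring
    rw [this]
    exact S.add_mem (S.mul_mem hN (S.pow_mem ha _)) (S.mul_mem hN' (S.pow_mem ha _))
  algebraMap_mem' c := ⟨0, by simp [S.algebraMap_mem]⟩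

lemma aeval_mem_awaySubalgebra {A σ : Type*} [CommRing A] [Algebra ℂ A] {S : Subalgebra ℂ A} {a : A}
    (ha : a ∈ S) {z : σ → A} (hz : ∀ i, ∃ N : ℕ, z i * a ^ N ∈ S) (p : MvPolynomial σ ℂ) :
    ∃ N : ℕ, aeval z p * a ^ N ∈ S := by
  have h : (aeval z : MvPolynomial σ ℂ →ₐ[ℂ] A).range ≤ awaySubalgebra S ha := by
    rw [← Algebra.adjoin_range_eq_range_aeval, Algebra.adjoin_le_iff]
    rintro _ ⟨i, rfl⟩
    exact hz i
  exact h ⟨p, rfl⟩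

/-- The family `w` presents the algebra `R` as the coordinate ring of `X_{m,n}`. -/
structure IsCoordSystem {R : Type*} [CommRing R] [Algebra ℂ R] (m n : ℕ) (w : Fin 4 → R) : Prop where
  surj : Function.Surjective (aeval w : MvPolynomial (Fin 4) ℂ →ₐ[ℂ] R)
  ker : ∀ p : MvPolynomial (Fin 4) ℂ, aeval w p = 0 ↔ p ∈ Ideal.span {equation m n}

lemma isCoordSystem_coordMk (m n : ℕ) :
    IsCoordSystem m n (fun i => coordMk (equation m n) (X i)) where
  surj a := by
    obtain ⟨p, rfl⟩ := coordMk_surjective _ a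
    exact ⟨p, aeval_coordMk _ p⟩
  ker p := by rw [aeval_coordMk, coordMk_eq_zero_iff]

namespace IsCoordSystem

variable {R : Type*} [CommRing R] [Algebra ℂ R] {m n : ℕ} {w : Fin 4 → R}

lemma map_equiv {R' : Type*} [CommRing R'] [Algebra ℂ R'] (hw : IsCoordSystem m n w)
    (e : R ≃ₐ[ℂ] R') : IsCoordSystem m n (fun i => e (w i)) where
  surj a := by
    obtain ⟨p, hp⟩ := hw.surj (e.symm a)
    refine ⟨p, ?_⟩
    exact (MvPolynomial.comp_aeval_apply w e.toAlgHom p).symm.trans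
      ((congrArg e hp).trans (e.apply_symm_apply a))
  ker p := by
    rw [← hw.ker, ← map_eq_zero_iff e e.injective]
    exact Eq.congr (MvPolynomial.comp_aeval_apply w e.toAlgHom p).symm rfl

lemma relation (hw : IsCoordSystem m n w) : w 0 ^ m * w 3 - w 1 ^ n * w 2 = 1 := by
  have := (hw.ker _).mpr (Ideal.mem_span_singleton_self _)
  simp only [equation, map_sub, map_mul, map_pow, aeval_X, map_one] at this
  exact sub_eq_zero.mp this

/-- The symmetry `(x, y, u, v) ↦ (y, x, -v, -u)`. -/
lemma swap (hw : IsCoordSystem m n w) : IsCoordSystem n m ![w 1, w 0, -w 3, -w 2] := by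
  let s : ∀ p : MvPolynomial (Fin 4) ℂ, MvPolynomial (Fin 4) ℂ :=
    fun p => aeval ![X 1, X 0, -X 3, -X 2] p
  have hs : ∀ p, aeval w (s p) = aeval ![w 1, w 0, -w 3, -w 2] p := by
    intro p
    have : (aeval w).comp (aeval ![X 1, X 0, -X 3, -X 2]) =
        (aeval ![w 1, w 0, -w 3, -w 2] : MvPolynomial (Fin 4) ℂ →ₐ[ℂ] R) := by
      ext i
      fin_cases i <;> simp
    exact DFunLike.congr_fun this p
  have hss : ∀ p, s (s p) = p := by
    intro p
    have : (aeval ![X 1, X 0, -X 3, -X 2]).comp (aeval ![X 1, X 0, -X 3, -X 2]) =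
        AlgHom.id ℂ (MvPolynomial (Fin 4) ℂ) := by
      ext i
      fin_cases i <;> simp
    exact DFunLike.congr_fun this p
  have hse : ∀ a b, s (equation a b) = equation b a := by
    intro a b
    simp [s, equation]
    ring
  have hspan : ∀ a b p, p ∈ Ideal.span {equation a b} → s p ∈ Ideal.span {equation b a} := by
    intro a b p hp
    obtain ⟨r, rfl⟩ := Ideal.mem_span_singleton'.mp hp
    refine Ideal.mem_span_singleton'.mpr ⟨s r, ?_⟩
    rw [← hse a b]
    simp only [s, map_mul]
  refine ⟨fun a => ?_, fun p => ?_⟩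
  · obtain ⟨p, hp⟩ := hw.surj a
    exact ⟨s p, by rw [← hs, hss, hp]⟩
  · rw [← hs, hw.ker]
    exact ⟨fun h => by simpa [hss] using hspan _ _ _ h, hspan _ _ _⟩

variable {K : Type*} [Field K] [Algebra ℂ K] {ι : R →ₐ[ℂ] K}

/-- Setting $u = tx^m$ and $v = (1+y^nu)/x^m$ with $x,y,t$ indeterminates solves the equation. The
resulting `ρ` from `R` to rational functions detects any relation between $x$, $y$ and $u/x^m$. -/
lemma algebraicIndependent (hw : IsCoordSystem m n w) (hι : Function.Injective ι)
    (hx : ι (w 0) ≠ 0) :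
    AlgebraicIndependent ℂ ![ι (w 0), ι (w 1), ι (w 2) / ι (w 0) ^ m] := by
  let M := FractionRing (MvPolynomial (Fin 3) ℂ)
  let c : MvPolynomial (Fin 3) ℂ →ₐ[ℂ] M := IsScalarTower.toAlgHom ℂ _ _
  have hcinj : Function.Injective c := IsFractionRing.injective _ _
  have hc0 : c (X 0) ≠ 0 := by
    rw [Ne, map_eq_zero_iff c hcinj]
    exact X_ne_zero 0
  let φ : MvPolynomial (Fin 4) ℂ →ₐ[ℂ] M := aeval ![c (X 0), c (X 1), c (X 2) * c (X 0) ^ m,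
    (1 + c (X 1) ^ n * (c (X 2) * c (X 0) ^ m)) / c (X 0) ^ m]
  have hφ : RingHom.ker (aeval w : MvPolynomial (Fin 4) ℂ →ₐ[ℂ] R).toRingHom ≤
      RingHom.ker φ.toRingHom := by
    intro p hp
    obtain ⟨r, rfl⟩ := Ideal.mem_span_singleton'.mp ((hw.ker p).mp hp)
    refine (map_mul _ _ _).trans ?_
    convert mul_zero _
    simp only [φ, equation, AlgHom.toRingHom_eq_coe, RingHom.coe_coe, map_sub, map_mul, map_pow,
      aeval_X, map_one, Matrix.cons_val]
    rw [mul_div_cancel₀ _ (pow_ne_zero m hc0)]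
    ring
  let ρ : R →ₐ[ℂ] M := AlgHom.liftOfSurjective (aeval w) hw.surj φ hφ
  have hρ : ∀ i, ρ (w i) = ![c (X 0), c (X 1), c (X 2) * c (X 0) ^ m,
      (1 + c (X 1) ^ n * (c (X 2) * c (X 0) ^ m)) / c (X 0) ^ m] i := by
    intro i
    have := AlgHom.liftOfSurjective_apply (aeval w) hw.surj φ hφ (X i)
    rw [aeval_X] at this
    exact this.trans (aeval_X _ _)
  rw [AlgebraicIndependent, injective_iff_map_eq_zero]
  intro f hf
  -- Denominators are cleared in the product `K × M`, so that one `r : R` represents both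
  -- components. Vanishing of the first forces `r = 0`, hence vanishing of the second.
  have h0 : ((ι (w 0), ρ (w 0)) : K × M) ∈ (ι.prod ρ).range := ⟨w 0, rfl⟩
  obtain ⟨N, r, hr⟩ := aeval_mem_awaySubalgebra h0
    (z := fun i => ((![ι (w 0), ι (w 1), ι (w 2) / ι (w 0) ^ m] i, c (X i)) : K × M)) (by
      intro i
      fin_cases i
      · exact ⟨0, w 0, by simp [hρ]⟩
      · exact ⟨0, w 1, by simp [hρ]⟩
      · exact ⟨m, w 2, by simp [hρ, hx]⟩) f
  have hfst : (aeval (fun i => ((![ι (w 0), ι (w 1), ι (w 2) / ι (w 0) ^ m] i, c (X i)) : K × M))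
      f).1 = 0 := by
    rw [← hf]
    exact MvPolynomial.comp_aeval_apply _ (AlgHom.fst ℂ K M) f
  have hsnd : (aeval (fun i => ((![ι (w 0), ι (w 1), ι (w 2) / ι (w 0) ^ m] i, c (X i)) : K × M))
      f).2 = c f := by
    refine (MvPolynomial.comp_aeval_apply _ (AlgHom.snd ℂ K M) f).trans ?_
    have : (aeval fun i => c (X i)) = c := by
      ext i
      simp
    exact DFunLike.congr_fun this f
  have hr1 := congrArg Prod.fst hr
  have hr2 := congrArg Prod.snd hr
  simp only [Prod.fst_mul, Prod.snd_mul, hfst, hsnd, zero_mul, Prod.pow_snd] at hr1 hr2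
  have hr0 : r = 0 := (map_eq_zero_iff ι hι).mp hr1
  rw [hr0] at hr2
  have h3 : c f * ρ (w 0) ^ N = 0 := by
    rw [← hr2]; simp
  rw [hρ 0] at h3
  have h4 : c f = 0 := (mul_eq_zero.mp h3).resolve_right (pow_ne_zero _ hc0)
  exact (map_eq_zero_iff c hcinj).mp h4

lemma isLocalizationIn (hw : IsCoordSystem m n w) (hι : Function.Injective ι) (P : Ideal R)
    [P.IsPrime] (hx : w 0 ∉ P) :
    IsLocalizationIn (polyRange ![ι (w 0), ι (w 1), ι (w 2) / ι (w 0) ^ m])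
      (localSubalgebra ι P) := by
  have hx0 : ι (w 0) ≠ 0 := by
    rw [Ne, map_eq_zero_iff ι hι]
    intro h
    exact hx (h ▸ P.zero_mem)
  have hpow : ∀ N, w 0 ^ N ∉ P := fun N h => hx (Ideal.IsPrime.mem_of_pow_mem inferInstance N h)
  set S := polyRange ![ι (w 0), ι (w 1), ι (w 2) / ι (w 0) ^ m] with hS
  have h0 : ι (w 0) ∈ S := mem_polyRange ![ι (w 0), ι (w 1), ι (w 2) / ι (w 0) ^ m] 0
  have h1 : ι (w 1) ∈ S := mem_polyRange ![ι (w 0), ι (w 1), ι (w 2) / ι (w 0) ^ m] 1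
  have h2 : ι (w 2) / ι (w 0) ^ m ∈ S :=
    mem_polyRange ![ι (w 0), ι (w 1), ι (w 2) / ι (w 0) ^ m] 2
  have h2' : ι (w 2) ∈ S := by
    have := S.mul_mem h2 (S.pow_mem h0 m)
    rwa [div_mul_cancel₀ _ (pow_ne_zero _ hx0)] at this
  -- Since $x^mv = 1+y^nu$, every regular function becomes a polynomial in $x,y,u/x^m$ after
  -- multiplication by a power of $x$, which is invertible at `P`.
  have key : ∀ r : R, ∃ N : ℕ, ι r * ι (w 0) ^ N ∈ S := by
    intro r
    obtain ⟨p, rfl⟩ := hw.surj r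
    have := aeval_mem_awaySubalgebra h0 (z := fun i => ι (w i)) (by
      intro i
      fin_cases i
      · exact ⟨0, by simpa using h0⟩
      · exact ⟨0, by simpa using h1⟩
      · exact ⟨0, by simpa using h2'⟩
      · refine ⟨m, ?_⟩
        have h3 : ι (w 3) * ι (w 0) ^ m = 1 + ι (w 1) ^ n * ι (w 2) := by
          have := congrArg ι hw.relation
          simp only [map_sub, map_mul, map_pow, map_one] at this
          linear_combination this
        exact h3 ▸ S.add_mem S.one_mem (S.mul_mem (S.pow_mem h1 n) h2')) p
    rwa [← MvPolynomial.comp_aeval_apply] at this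
  refine ⟨?_, ?_⟩
  · rw [hS, polyRange, ← Algebra.adjoin_range_eq_range_aeval, Algebra.adjoin_le_iff]
    rintro _ ⟨i, rfl⟩
    fin_cases i
    · exact apply_mem_localSubalgebra ι P _
    · exact apply_mem_localSubalgebra ι P _
    · exact ⟨w 2, w 0 ^ m, hpow m, by simp [hx0]⟩
  · rintro r ⟨a, b, hb, hab⟩
    obtain ⟨N, hN⟩ := key b
    obtain ⟨N', hN'⟩ := key a
    have hmem : b * w 0 ^ N * w 0 ^ N' ∉ P := by
      intro h
      rcases Ideal.IsPrime.mem_or_mem inferInstance h with h | h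
      · rcases Ideal.IsPrime.mem_or_mem inferInstance h with h | h
        · exact hb h
        · exact hpow _ h
      · exact hpow _ h
    have hinv := inv_mem_localSubalgebra hι hmem
    have hne : ι (b * w 0 ^ N * w 0 ^ N') ≠ 0 := by
      rw [Ne, map_eq_zero_iff ι hι]
      intro h
      exact hmem (h ▸ P.zero_mem)
    refine ⟨_, ?_, hne, hinv, ?_⟩
    · simp only [map_mul, map_pow]
      exact S.mul_mem hN (S.pow_mem h0 _)
    · have : r * ι (b * w 0 ^ N * w 0 ^ N') = (ι a * ι (w 0) ^ N') * ι (w 0) ^ N := by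
        simp only [map_mul, map_pow, ← hab]
        ring
      rw [this]
      exact S.mul_mem hN' (S.pow_mem h0 _)

end IsCoordSystem

/-- The automorphism `(x, y, t) ↦ (y, x, -t)` of a polynomial algebra. -/
lemma aeval_swap {K : Type*} [Field K] [Algebra ℂ K] (x y t : K) (p : MvPolynomial (Fin 3) ℂ) :
    aeval ![y, x, -t] (aeval ![X 1, X 0, -X 2] p : MvPolynomial (Fin 3) ℂ) = aeval ![x, y, t] p := by
  have : (aeval ![y, x, -t]).comp (aeval ![X 1, X 0, -X 2]) =
      (aeval ![x, y, t] : MvPolynomial (Fin 3) ℂ →ₐ[ℂ] K) := by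
    ext i
    fin_cases i <;> simp
  exact DFunLike.congr_fun this p

lemma polyRange_swap_le {K : Type*} [Field K] [Algebra ℂ K] (x y t : K) :
    polyRange ![x, y, t] ≤ polyRange ![y, x, -t] := by
  rintro _ ⟨p, rfl⟩
  exact ⟨_, aeval_swap x y t p⟩

lemma polyRange_swap {K : Type*} [Field K] [Algebra ℂ K] (x y t : K) :
    polyRange ![x, y, t] = polyRange ![y, x, -t] := by
  refine le_antisymm (polyRange_swap_le x y t) ?_
  have := polyRange_swap_le y x (-t)
  rwa [neg_neg] at this

lemma algebraicIndependent_swap {K : Type*} [Field K] [Algebra ℂ K] {x y t : K}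
    (h : AlgebraicIndependent ℂ ![y, x, -t]) : AlgebraicIndependent ℂ ![x, y, t] := by
  have hs : Function.Injective
      (aeval ![X 1, X 0, -X 2] : MvPolynomial (Fin 3) ℂ →ₐ[ℂ] MvPolynomial (Fin 3) ℂ) := by
    refine Function.LeftInverse.injective (g := aeval ![X 1, X 0, -X 2]) fun p => ?_
    have : (aeval ![X 1, X 0, -X 2]).comp (aeval ![X 1, X 0, -X 2]) =
        AlgHom.id ℂ (MvPolynomial (Fin 3) ℂ) := by
      ext i
      fin_cases i <;> simp
    exact DFunLike.congr_fun this p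
  intro p q hpq
  refine hs (h ?_)
  exact (aeval_swap x y t p).trans (hpq.trans (aeval_swap x y t q).symm)

lemma sub_div_pow_eq_one {K : Type*} [Field K] {x y u v : K} {m n : ℕ} (hx : x ≠ 0) (hy : y ≠ 0)
    (h : x ^ m * v - y ^ n * u = 1) : x ^ m * y ^ n * (v / y ^ n - u / x ^ m) = 1 := by
  rw [← h]
  field_simp

/-- The coordinate ring of `X_{m,n}` is isomorphic to that of `SL₂` only if `m + n = 2`. -/
theorem add_eq_two_of_coordRing_equiv {m n : ℕ} (hm : 1 ≤ m) (hn : 1 ≤ n)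
    (e : CoordRing (equation 1 1) ≃ₐ[ℂ] CoordRing (equation m n)) : m + n = 2 := by
  let R := CoordRing (equation m n)
  let K := FractionRing R
  let ι : R →ₐ[ℂ] K := IsScalarTower.toAlgHom ℂ R K
  have hι : Function.Injective ι := IsFractionRing.injective R K
  let w : Fin 4 → R := fun i => coordMk (equation m n) (X i)
  have hw : IsCoordSystem m n w := isCoordSystem_coordMk m n
  have hz := (isCoordSystem_coordMk 1 1).map_equiv e
  have hrel := congrArg ι hw.relation
  simp only [map_sub, map_mul, map_pow, map_one] at hrel
  have hfrac : HasFractions ι.range := by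
    intro r
    obtain ⟨a, b, hb, rfl⟩ := IsFractionRing.div_surjective (A := R) r
    have hb0 : ι b ≠ 0 := by
      rw [Ne, map_eq_zero_iff ι hι]
      exact nonZeroDivisors.ne_zero hb
    exact ⟨ι b, ⟨b, rfl⟩, hb0, a, (div_mul_cancel₀ _ hb0).symm⟩
  have hne : ∀ j : Fin 4, j = 0 ∨ j = 1 → ι (w j) ≠ 0 := by
    intro j hj h
    rw [map_eq_zero_iff ι hι] at h
    have h2 : X j ∈ Ideal.span {equation m n} := coordMk_eq_zero_iff.mp h
    obtain ⟨r, hr⟩ := Ideal.mem_span_singleton'.mp h2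
    -- The point $(1,1,0,1)$ lies on $X_{m,n}$, and neither $x$ nor $y$ vanishes there.
    have h3 := congrArg (eval ![(1 : ℂ), 1, 0, 1]) hr
    rcases hj with rfl | rfl <;> simp [equation] at h3
  have hx0 := hne 0 (Or.inl rfl)
  have hy0 := hne 1 (Or.inr rfl)
  classical
  -- The fibre coordinate is $u/x^m$ where $x$ is invertible and $v/y^n$ elsewhere, where $y$ is
  -- invertible by `hy`.
  let t : PrimeSpectrum R → K := fun P =>
    if w 0 ∈ P.asIdeal then ι (w 3) / ι (w 1) ^ n else ι (w 2) / ι (w 0) ^ m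
  have hy : ∀ P : PrimeSpectrum R, w 0 ∈ P.asIdeal → w 1 ∉ P.asIdeal := by
    intro P hx hy
    have h1 : w 0 ^ m * w 3 - w 1 ^ n * w 2 ∈ P.asIdeal :=
      P.asIdeal.sub_mem (P.asIdeal.mul_mem_right _ (P.asIdeal.pow_mem_of_mem hx m hm))
        (P.asIdeal.mul_mem_right _ (P.asIdeal.pow_mem_of_mem hy n hn))
    rw [hw.relation] at h1
    exact P.isPrime.ne_top ((Ideal.eq_top_iff_one _).mpr h1)
  have hswap : ι (-w 3) / ι (w 1) ^ n = -(ι (w 3) / ι (w 1) ^ n) := by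
    rw [map_neg, neg_div]
  have hd : ((m + n : ℕ) : ℤ) = 2 := by
    refine degree_eq_two_of_local hι hfrac hz.surj hz.ker (x := ι (w 0)) (y := ι (w 1)) (t := t)
      ?_ ?_ ?_
    · intro P
      by_cases hP : w 0 ∈ P.asIdeal
      · simp only [t, if_pos hP]
        have := hw.swap.algebraicIndependent hι hy0
        exact algebraicIndependent_swap (hswap ▸ this)
      · simp only [t, if_neg hP]
        exact hw.algebraicIndependent hι hx0
    · intro P
      by_cases hP : w 0 ∈ P.asIdeal
      · simp only [t, if_pos hP]
        have := hw.swap.isLocalizationIn hι P.asIdeal (hy P hP)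
        rw [polyRange_swap]
        exact hswap ▸ this
      · simp only [t, if_neg hP]
        exact hw.isLocalizationIn hι P.asIdeal hP
    · have hq : (X 0 ^ m * X 1 ^ n : MvPolynomial (Fin 2) ℂ).IsHomogeneous (m + n) :=
        (isHomogeneous_X_pow 0 m).mul (isHomogeneous_X_pow 1 n)
      have hq0 : (X 0 ^ m * X 1 ^ n : MvPolynomial (Fin 2) ℂ) ≠ 0 :=
        mul_ne_zero (pow_ne_zero _ (X_ne_zero 0)) (pow_ne_zero _ (X_ne_zero 1))
      intro P Q
      -- Each transition function is $p/(x^my^n)$ with $p\in\{0,1,-1\}$, homogeneous of degree $0$.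
      have key : ∀ p : MvPolynomial (Fin 2) ℂ, p.IsHomogeneous 0 →
          ι (w 0) ^ m * ι (w 1) ^ n * (t P - t Q) = aeval ![ι (w 0), ι (w 1)] p →
          DiffHomogeneous (ι (w 0)) (ι (w 1)) (-((m + n : ℕ) : ℤ)) (t P) (t Q) := by
        intro p hp h
        refine ⟨0, m + n, p, _, hp, hq, hq0, by simp, ?_⟩
        simpa using h
      by_cases hP : w 0 ∈ P.asIdeal <;> by_cases hQ : w 0 ∈ Q.asIdeal
      · exact key 0 (isHomogeneous_zero _ _ _) (by simp [t, hP, hQ])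
      · refine key 1 (isHomogeneous_one _ _) ?_
        simp only [t, if_pos hP, if_neg hQ, map_one]
        exact sub_div_pow_eq_one hx0 hy0 hrel
      · refine key (-1) (isHomogeneous_one _ _).neg ?_
        simp only [t, if_pos hQ, if_neg hP, map_one, map_neg]
        rw [← sub_div_pow_eq_one hx0 hy0 hrel]
        ring
      · exact key 0 (isHomogeneous_zero _ _ _) (by simp [t, hP, hQ])
  exact_mod_cast hd

end ExoticSphere

end

noncomputable section

namespace ExoticSphere

open CategoryTheory AlgebraicGeometry

/-! ### Diffeomorphisms of hypersurfaces -/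

lemma value_comp {V V' : Over SpecC} (i : V ⟶ V') (g : Γ(V'.left, ⊤)) (z : Points V) :
    value g (z ≫ i) = value (i.left.appTop g) z := by
  simp only [value, Over.comp_left, Scheme.Hom.comp_appTop, CommRingCat.comp_apply]

lemma IsSmoothFun.comp_hom {V V' : Over SpecC} (i : V ⟶ V') {s : Points V' → ℂ}
    (hs : IsSmoothFun s) : IsSmoothFun (fun z : Points V => s (z ≫ i)) := by
  intro z
  obtain ⟨k, f, W, G, hW, hz, hG, hs⟩ := hs (z ≫ i)
  refine ⟨k, fun j => i.left.appTop (f j), W, G, hW, ?_, hG, fun w hw => ?_⟩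
  · simpa only [value_comp] using hz
  · simpa only [value_comp] using hs (w ≫ i) (by simpa only [value_comp] using hw)

lemma Diffeomorphic.trans_iso {V V' V'' : Over SpecC} (h : Diffeomorphic V V') (i : V' ≅ V'') :
    Diffeomorphic V V'' := by
  obtain ⟨φ, h1, h2⟩ := h
  refine ⟨φ.trans i.homToEquiv, fun g => ?_, fun f => ?_⟩
  · have := h1 (i.hom.left.appTop g)
    simpa only [Equiv.trans_apply, Iso.homToEquiv_apply, value_comp] using this
  · exact (h2 f).comp_hom i.inv

/-! ### Complex points of a hypersurface in coordinates -/

section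

variable {σ : Type} {f : MvPolynomial σ ℂ}

/-- A polynomial as a regular function on a hypersurface. -/
def regFun (f p : MvPolynomial σ ℂ) : Γ((hypersurface f).left, ⊤) :=
  (Scheme.ΓSpecIso (CommRingCat.of (CoordRing f))).inv (coordMk f p)

lemma regFun_surjective (g : Γ((hypersurface f).left, ⊤)) : ∃ p, regFun f p = g := by
  obtain ⟨a, rfl⟩ := (ConcreteCategory.bijective_of_isIso
    (Scheme.ΓSpecIso (CommRingCat.of (CoordRing f))).inv).2 g
  obtain ⟨p, rfl⟩ := coordMk_surjective f a
  exact ⟨p, rfl⟩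

/-- The homomorphism `ℂ[V] → ℂ` that corresponds to a complex point. -/
def pointHom (z : Points (hypersurface f)) : CoordRing f →ₐ[ℂ] ℂ where
  toRingHom := (Spec.preimage (R := CommRingCat.of (CoordRing f)) (S := CommRingCat.of ℂ) z.left).hom
  commutes' c := by
    have h1 : z.left ≫ Spec.map (CommRingCat.ofHom (algebraMap ℂ (CoordRing f))) = 𝟙 SpecC :=
      Over.w z
    have h2 : Spec.map (CommRingCat.ofHom (algebraMap ℂ (CoordRing f)) ≫
        Spec.preimage (R := CommRingCat.of (CoordRing f)) (S := CommRingCat.of ℂ) z.left) =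
          Spec.map (𝟙 (CommRingCat.of ℂ)) := by
      refine (Spec.map_comp _ _).trans ?_
      refine (congrArg (· ≫ Spec.map (CommRingCat.ofHom (algebraMap ℂ (CoordRing f))))
        (Spec.map_preimage (R := CommRingCat.of (CoordRing f)) (S := CommRingCat.of ℂ)
          z.left)).trans ?_
      exact h1.trans (Spec.map_id _).symm
    exact ConcreteCategory.congr_hom (Spec.map_injective h2) c

lemma specMap_pointHom (z : Points (hypersurface f)) :
    Spec.map (CommRingCat.ofHom (pointHom z).toRingHom) = z.left :=
  Spec.map_preimage (R := CommRingCat.of (CoordRing f)) (S := CommRingCat.of ℂ) z.left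

/-- The coordinates of a complex point. -/
def pointCoord (z : Points (hypersurface f)) (i : σ) : ℂ := pointHom z (coordMk f (MvPolynomial.X i))

lemma pointHom_coordMk (z : Points (hypersurface f)) (p : MvPolynomial σ ℂ) :
    pointHom z (coordMk f p) = MvPolynomial.eval (pointCoord z) p := by
  have : (pointHom z).comp (coordMk f) = MvPolynomial.aeval (pointCoord z) := by
    ext i
    simp [pointCoord]
  exact DFunLike.congr_fun this p

lemma value_regFun (z : Points (hypersurface f)) (p : MvPolynomial σ ℂ) :
    value (regFun f p) z = MvPolynomial.eval (pointCoord z) p := by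
  rw [← pointHom_coordMk, value, ← specMap_pointHom z, regFun]
  have h := Scheme.ΓSpecIso_inv_naturality (CommRingCat.ofHom (pointHom z).toRingHom)
  have h2 := ConcreteCategory.congr_hom h (coordMk f p)
  refine (congrArg (Scheme.ΓSpecIso (CommRingCat.of ℂ)).hom h2.symm).trans ?_
  exact ConcreteCategory.congr_hom (Scheme.ΓSpecIso (CommRingCat.of ℂ)).inv_hom_id _

lemma eval_pointCoord (z : Points (hypersurface f)) : MvPolynomial.eval (pointCoord z) f = 0 := by
  rw [← pointHom_coordMk, coordMk_self, map_zero]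

lemma pointCoord_injective : Function.Injective (pointCoord (f := f)) := by
  intro z z' h
  have h1 : pointHom z = pointHom z' := coordRing_hom_ext fun i => congrFun h i
  ext1
  rw [← specMap_pointHom, ← specMap_pointHom, h1]

/-- The complex point with given coordinates. -/
def mkPoint (v : σ → ℂ) (hv : MvPolynomial.eval v f = 0) : Points (hypersurface f) :=
  Over.homMk (Spec.map (CommRingCat.ofHom (coordLift v hv).toRingHom)) (by
    have : CommRingCat.ofHom (algebraMap ℂ (CoordRing f)) ≫
        CommRingCat.ofHom (coordLift v hv).toRingHom = 𝟙 (CommRingCat.of ℂ) := by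
      ext c
      exact (coordLift v hv).commutes c
    refine (Spec.map_comp _ _).symm.trans ?_
    rw [this, Spec.map_id]
    rfl)

lemma pointCoord_mkPoint (v : σ → ℂ) (hv : MvPolynomial.eval v f = 0) :
    pointCoord (mkPoint v hv) = v := by
  have h : CommRingCat.ofHom (pointHom (mkPoint v hv)).toRingHom =
      CommRingCat.ofHom (coordLift v hv).toRingHom :=
    Spec.map_injective (specMap_pointHom (mkPoint v hv))
  ext i
  have := ConcreteCategory.congr_hom h (coordMk f (MvPolynomial.X i))
  refine Eq.trans this ?_
  exact MvPolynomial.aeval_X v i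

end

lemma contDiff_eval {σ : Type} [Fintype σ] (p : MvPolynomial σ ℂ) :
    ContDiff ℝ ((⊤ : ℕ∞) : WithTop ℕ∞) (fun v : σ → ℂ => MvPolynomial.eval v p) := by
  induction p using MvPolynomial.induction_on with
  | C a => simpa using contDiff_const
  | add p q hp hq => simpa using hp.add hq
  | mul_X p i hp => simpa using hp.mul (contDiff_apply ℝ ℂ i)

/-- Two hypersurfaces are diffeomorphic if their zero sets are related by mutually inverse maps
that are smooth on open neighbourhoods. -/
lemma diffeomorphic_of_contDiffOn {k l : ℕ} {f : MvPolynomial (Fin k) ℂ}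
    {g : MvPolynomial (Fin l) ℂ} {Φ : (Fin k → ℂ) → Fin l → ℂ} {Ψ : (Fin l → ℂ) → Fin k → ℂ}
    {W : Set (Fin k → ℂ)} {W' : Set (Fin l → ℂ)} (hW : IsOpen W) (hW' : IsOpen W')
    (hΦ : ContDiffOn ℝ ((⊤ : ℕ∞) : WithTop ℕ∞) Φ W)
    (hΨ : ContDiffOn ℝ ((⊤ : ℕ∞) : WithTop ℕ∞) Ψ W')
    (hf : ∀ v, MvPolynomial.eval v f = 0 →
      v ∈ W ∧ MvPolynomial.eval (Φ v) g = 0 ∧ Ψ (Φ v) = v)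
    (hg : ∀ v, MvPolynomial.eval v g = 0 →
      v ∈ W' ∧ MvPolynomial.eval (Ψ v) f = 0 ∧ Φ (Ψ v) = v) :
    Diffeomorphic (hypersurface f) (hypersurface g) := by
  -- The coordinate functions and the single open set `W` serve at every point in the definition of
  -- smoothness.
  have smooth : ∀ {k l : ℕ} {f : MvPolynomial (Fin k) ℂ} {g : MvPolynomial (Fin l) ℂ}
      {Φ : (Fin k → ℂ) → Fin l → ℂ} {W : Set (Fin k → ℂ)} (φ : Points (hypersurface f) →
      Points (hypersurface g)), (∀ z, pointCoord (φ z) = Φ (pointCoord z)) → IsOpen W →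
      ContDiffOn ℝ ((⊤ : ℕ∞) : WithTop ℕ∞) Φ W → (∀ v, MvPolynomial.eval v f = 0 → v ∈ W) →
      ∀ r : Γ((hypersurface g).left, ⊤), IsSmoothFun (fun z => value r (φ z)) := by
    intro k l f g Φ W φ hφ hW hΦ hf r z
    obtain ⟨p, rfl⟩ := regFun_surjective r
    have hcoord : ∀ w : Points (hypersurface f),
        (fun i => value (regFun f (MvPolynomial.X i)) w) = pointCoord w := by
      intro w
      ext i
      rw [value_regFun, MvPolynomial.eval_X]
    refine ⟨k, fun i => regFun f (MvPolynomial.X i), W, fun v => MvPolynomial.eval (Φ v) p, hW, ?_,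
      (contDiff_eval p).comp_contDiffOn hΦ, fun w _ => ?_⟩
    · rw [hcoord]
      exact hf _ (eval_pointCoord z)
    · simp only [value_regFun, hφ, MvPolynomial.eval_X]
  let φ : Points (hypersurface f) ≃ Points (hypersurface g) :=
    { toFun := fun z => mkPoint (Φ (pointCoord z)) (hf _ (eval_pointCoord z)).2.1
      invFun := fun z => mkPoint (Ψ (pointCoord z)) (hg _ (eval_pointCoord z)).2.1
      left_inv := fun z => pointCoord_injective (by
        rw [pointCoord_mkPoint, pointCoord_mkPoint, (hf _ (eval_pointCoord z)).2.2])
      right_inv := fun z => pointCoord_injective (by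
        rw [pointCoord_mkPoint, pointCoord_mkPoint, (hg _ (eval_pointCoord z)).2.2]) }
  exact ⟨φ, smooth φ (fun z => pointCoord_mkPoint _ _) hW hΦ fun v hv => (hf v hv).1,
    smooth φ.symm (fun z => pointCoord_mkPoint _ _) hW' hΨ fun v hv => (hg v hv).1⟩

/-! ### The diffeomorphism between `X_{m,n}` and `X_{m',n'}` -/

/-- The function `|x|^{2m} + |y|^{2n}`. -/
def normSum (m n : ℕ) (w : Fin 4 → ℂ) : ℂ :=
  w 0 ^ m * (starRingEnd ℂ (w 0)) ^ m + w 1 ^ n * (starRingEnd ℂ (w 1)) ^ n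

/-- The fibre coordinate of the smoothly trivial bundle `X_{m,n}` over the punctured plane. -/
def fibreCoord (m n : ℕ) (w : Fin 4 → ℂ) : ℂ :=
  ((starRingEnd ℂ (w 0)) ^ m * w 2 + (starRingEnd ℂ (w 1)) ^ n * w 3) * (normSum m n w)⁻¹

/-- The map from `X_{m,n}` to `X_{m',n'}` over the punctured plane that preserves the
fibre coordinates. -/
def fibreMap (m n m' n' : ℕ) (w : Fin 4 → ℂ) : Fin 4 → ℂ :=
  -- The vector $(-\bar y^{n'},\bar x^{m'})/N'$, with $N'$ the `normSum`, solves the equation of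
  -- $X_{m',n'}$ and has fibre coordinate $0$. Adding $s(x^{m'},y^{n'})$ preserves the equation and
  -- adds $s$ to the fibre coordinate.
  ![w 0, w 1,
    -(starRingEnd ℂ (w 1)) ^ n' * (normSum m' n' w)⁻¹ + fibreCoord m n w * w 0 ^ m',
    (starRingEnd ℂ (w 0)) ^ m' * (normSum m' n' w)⁻¹ + fibreCoord m n w * w 1 ^ n']

lemma normSum_ne_zero {m n : ℕ} {w : Fin 4 → ℂ} (hw : w 0 ≠ 0 ∨ w 1 ≠ 0) :
    normSum m n w ≠ 0 := by
  have h : normSum m n w = ((Complex.normSq (w 0) ^ m + Complex.normSq (w 1) ^ n : ℝ) : ℂ) := by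
    rw [normSum, ← mul_pow, ← mul_pow, Complex.mul_conj, Complex.mul_conj]
    push_cast
    rfl
  rw [h, Complex.ofReal_ne_zero]
  have h0 := Complex.normSq_nonneg (w 0)
  have h1 := Complex.normSq_nonneg (w 1)
  rcases hw with hw | hw
  · have := pow_pos (Complex.normSq_pos.mpr hw) m
    have := pow_nonneg h1 n
    positivity
  · have := pow_pos (Complex.normSq_pos.mpr hw) n
    have := pow_nonneg h0 m
    positivity

lemma contDiff_conj_apply (i : Fin 4) : ContDiff ℝ ((⊤ : ℕ∞) : WithTop ℕ∞)
    (fun w : Fin 4 → ℂ => starRingEnd ℂ (w i)) :=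
  Complex.conjCLE.contDiff.comp (contDiff_apply ℝ ℂ i)

lemma contDiff_normSum (m n : ℕ) :
    ContDiff ℝ ((⊤ : ℕ∞) : WithTop ℕ∞) (normSum m n) :=
  (((contDiff_apply ℝ ℂ 0).pow m).mul ((contDiff_conj_apply 0).pow m)).add
    (((contDiff_apply ℝ ℂ 1).pow n).mul ((contDiff_conj_apply 1).pow n))

lemma contDiffOn_fibreMap (m n m' n' : ℕ) :
    ContDiffOn ℝ ((⊤ : ℕ∞) : WithTop ℕ∞) (fibreMap m n m' n') {w | w 0 ≠ 0 ∨ w 1 ≠ 0} := by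
  have hinv : ∀ m n : ℕ, ContDiffOn ℝ ((⊤ : ℕ∞) : WithTop ℕ∞)
      (fun w => (normSum m n w)⁻¹) {w | w 0 ≠ 0 ∨ w 1 ≠ 0} := fun m n =>
    (contDiff_normSum m n).contDiffOn.inv fun w hw => normSum_ne_zero hw
  have hc : ∀ i : Fin 4, ContDiffOn ℝ ((⊤ : ℕ∞) : WithTop ℕ∞) (fun w : Fin 4 → ℂ => w i)
      {w | w 0 ≠ 0 ∨ w 1 ≠ 0} := fun i => (contDiff_apply ℝ ℂ i).contDiffOn
  have hb : ∀ i : Fin 4, ContDiffOn ℝ ((⊤ : ℕ∞) : WithTop ℕ∞)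
      (fun w : Fin 4 → ℂ => starRingEnd ℂ (w i)) {w | w 0 ≠ 0 ∨ w 1 ≠ 0} := fun i =>
    (contDiff_conj_apply i).contDiffOn
  have hs : ContDiffOn ℝ ((⊤ : ℕ∞) : WithTop ℕ∞) (fibreCoord m n) {w | w 0 ≠ 0 ∨ w 1 ≠ 0} :=
    ((((hb 0).pow m).mul (hc 2)).add (((hb 1).pow n).mul (hc 3))).mul (hinv m n)
  rw [contDiffOn_pi]
  intro i
  fin_cases i
  · exact hc 0
  · exact hc 1
  · exact ((((hb 1).pow n').neg).mul (hinv m' n')).add (hs.mul ((hc 0).pow m'))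
  · exact (((hb 0).pow m').mul (hinv m' n')).add (hs.mul ((hc 1).pow n'))

/-- A point of $X_{m,n}$ is recovered from its base point and its fibre coordinate. Both are
preserved by the map, so exchanging the exponents gives the inverse. -/
lemma fibreMap_spec {m n : ℕ} (hm : 1 ≤ m) (hn : 1 ≤ n) (m' n' : ℕ)
    {w : Fin 4 → ℂ} (hw : MvPolynomial.eval w (equation m n) = 0) :
    (w 0 ≠ 0 ∨ w 1 ≠ 0) ∧ MvPolynomial.eval (fibreMap m n m' n' w) (equation m' n') = 0 ∧
      fibreMap m' n' m n (fibreMap m n m' n' w) = w := by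
  simp only [equation, map_sub, map_mul, map_pow, MvPolynomial.eval_X, map_one] at hw
  have hne : w 0 ≠ 0 ∨ w 1 ≠ 0 := by
    by_contra! h
    rw [h.1, h.2, zero_pow (by omega), zero_pow (by omega)] at hw
    simp at hw
  have hN := normSum_ne_zero (m := m) (n := n) hne
  have hN' := normSum_ne_zero (m := m') (n := n') hne
  have e0 : fibreMap m n m' n' w 0 = w 0 := rfl
  have e1 : fibreMap m n m' n' w 1 = w 1 := rfl
  have e2 : fibreMap m n m' n' w 2 = -(starRingEnd ℂ (w 1)) ^ n' * (normSum m' n' w)⁻¹ +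
    fibreCoord m n w * w 0 ^ m' := rfl
  have e3 : fibreMap m n m' n' w 3 = (starRingEnd ℂ (w 0)) ^ m' * (normSum m' n' w)⁻¹ +
    fibreCoord m n w * w 1 ^ n' := rfl
  have hnorm : ∀ a b, normSum a b (fibreMap m n m' n' w) = normSum a b w := fun _ _ => rfl
  have hM' : normSum m' n' w = w 0 ^ m' * (starRingEnd ℂ (w 0)) ^ m' +
    w 1 ^ n' * (starRingEnd ℂ (w 1)) ^ n' := rfl
  have hM : normSum m n w = w 0 ^ m * (starRingEnd ℂ (w 0)) ^ m +
    w 1 ^ n * (starRingEnd ℂ (w 1)) ^ n := rfl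
  have hi : normSum m n w * (normSum m n w)⁻¹ = 1 := mul_inv_cancel₀ hN
  have hi' : normSum m' n' w * (normSum m' n' w)⁻¹ = 1 := mul_inv_cancel₀ hN'
  have hs : fibreCoord m' n' (fibreMap m n m' n' w) = fibreCoord m n w := by
    rw [fibreCoord, hnorm, e0, e1, e2, e3]
    linear_combination fibreCoord m n w * hi' - fibreCoord m n w * (normSum m' n' w)⁻¹ * hM'
  have hfc : fibreCoord m n w = ((starRingEnd ℂ (w 0)) ^ m * w 2 + (starRingEnd ℂ (w 1)) ^ n * w 3) *
    (normSum m n w)⁻¹ := rfl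
  refine ⟨hne, ?_, ?_⟩
  · simp only [equation, map_sub, map_mul, map_pow, MvPolynomial.eval_X, map_one]
    rw [e0, e1, e2, e3]
    linear_combination hi' - (normSum m' n' w)⁻¹ * hM'
  · have key : fibreMap m' n' m n (fibreMap m n m' n' w) = ![w 0, w 1,
        -(starRingEnd ℂ (w 1)) ^ n * (normSum m n w)⁻¹ + fibreCoord m n w * w 0 ^ m,
        (starRingEnd ℂ (w 0)) ^ m * (normSum m n w)⁻¹ + fibreCoord m n w * w 1 ^ n] := by
      rw [fibreMap, hs]
      rfl
    rw [key]
    ext i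
    fin_cases i
    · rfl
    · rfl
    · change -(starRingEnd ℂ (w 1)) ^ n * (normSum m n w)⁻¹ + fibreCoord m n w * w 0 ^ m = w 2
      linear_combination w 0 ^ m * hfc + w 2 * hi - w 2 * (normSum m n w)⁻¹ * hM +
        (starRingEnd ℂ (w 1)) ^ n * (normSum m n w)⁻¹ * hw
    · change (starRingEnd ℂ (w 0)) ^ m * (normSum m n w)⁻¹ + fibreCoord m n w * w 1 ^ n = w 3
      linear_combination w 1 ^ n * hfc + w 3 * hi - w 3 * (normSum m n w)⁻¹ * hM -
        (starRingEnd ℂ (w 0)) ^ m * (normSum m n w)⁻¹ * hw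

lemma diffeomorphic_Xmn {m n m' n' : ℕ} (hm : 1 ≤ m) (hn : 1 ≤ n) (hm' : 1 ≤ m')
    (hn' : 1 ≤ n') : Diffeomorphic (Xmn m n) (Xmn m' n') := by
  have hopen : IsOpen {w : Fin 4 → ℂ | w 0 ≠ 0 ∨ w 1 ≠ 0} :=
    (isOpen_ne_fun (continuous_apply 0) continuous_const).union
      (isOpen_ne_fun (continuous_apply 1) continuous_const)
  exact diffeomorphic_of_contDiffOn (f := equation m n) (g := equation m' n') hopen hopen
    (contDiffOn_fibreMap m n m' n') (contDiffOn_fibreMap m' n' m n)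
    (fun w hw => fibreMap_spec hm hn m' n' hw) (fun w hw => fibreMap_spec hm' hn' m n hw)

/-- For `m + n ≥ 3`, the variety `X_{m,n}` is an exotic affine sphere. -/
theorem isExoticSphere_Xmn {m n : ℕ} (hm : 1 ≤ m) (hn : 1 ≤ n) (hmn : 3 ≤ m + n) :
    IsExoticSphere 3 (Xmn m n) where
  isAffine := inferInstanceAs (IsAffine (Spec (CommRingCat.of (CoordRing (equation m n)))))
  isIntegral := inferInstance
  smooth := by
    have h : (algebraMap ℂ (CoordRing (equation m n))).Smooth := by
      rw [RingHom.smooth_algebraMap]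
      infer_instance
    exact (HasRingHomProperty.Spec_iff (P := @Smooth) (Q := RingHom.Smooth)
      (φ := CommRingCat.ofHom (algebraMap ℂ (CoordRing (equation m n))))).mpr h
  -- The sphere is reached through $X_{1,1}$, the only member of the family for which the algebraic
  -- isomorphism is used.
  diffeomorphic :=
    (diffeomorphic_Xmn hm hn le_rfl le_rfl).trans_iso (isoXmnSL2 ≪≫ isoSL2Sphere)
  not_iso := ⟨fun i => by
    have := add_eq_two_of_coordRing_equiv hm hn
      (coordRingEquiv (f := equation m n) (g := equation 1 1)
        (i ≪≫ isoSL2Sphere.symm ≪≫ isoXmnSL2.symm))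
    omega⟩

end ExoticSphere

end

theorem mainTheorem3 :
    (∀ (B : ExoticSphere.GaBundle ExoticSphere.A2star) (d : ℕ), 2 < d →
      B.IsNontrivial → B.IsHomogeneous (-(d : ℤ)) →
        IsEmpty (CategoryTheory.Iso B.totalSpace (ExoticSphere.Xmn 1 1))) ∧
    Nonempty (CategoryTheory.Iso (ExoticSphere.Xmn 1 1) ExoticSphere.SL2) ∧
    Nonempty (CategoryTheory.Iso ExoticSphere.SL2 (ExoticSphere.sphere 3)) ∧
    (∀ m n : ℕ, 1 ≤ m → 1 ≤ n → 3 ≤ m + n →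
      ExoticSphere.IsExoticSphere 3 (ExoticSphere.Xmn m n)) := by
  refine ⟨fun B d hd _ hB => ⟨fun i => ?_⟩, ⟨ExoticSphere.isoXmnSL2⟩,
    ⟨ExoticSphere.isoSL2Sphere⟩, fun m n => ExoticSphere.isExoticSphere_Xmn⟩
  have := ExoticSphere.GaBundle.degree_eq_two hB i
  omega
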